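/- Let $\mathcal H$ be a separable complex Hilbert space (inner product linear in the second variable) and $H$ a self-adjoint operator on $\mathcal H$ with spectral measure $E_H$. For $\psi\in\mathcal H$ put $\mu_\psi(B)=\|E_H(B)\psi\|^2$ for Borel sets $B\subset\mathbb R$. A non-zero vector $\phi\in\bigcap_{n\ge1}D(H^n)$ is cyclic for $H$ if the linear hull of $\{H^n\phi : n\ge 0\}$ is dense in $\mathcal H$. Call a cyclic vector $\phi$ *regular* if $\mu_\phi$ has a density $\rho_\phi\ge0$ with respect to Lebesgue measure which is differentiable on $\mathbb R$ and satisfies $$\lim_{\lambda\to\pm\infty}\rho_\phi(\lambda)=0,\qquad \int_{\{\rho_\phi>0\}}\frac{\rho_\phi'(\lambda)^2}{\rho_\phi(\lambda)}\,d\lambda<\infty .$$ Suppose that $H\in S_0(\mathcal H)$, i.e. that $H$ is absolutely continuous ($\mu_\psi$ is absolutely continuous with respect to Lebesgue measure for every $\psi\in\mathcal H$) and has a regular cyclic vector. Then $H$ has a strong time operator, i.e. there is a densely defined symmetric operator $T$ on $\mathcal H$ such that, for all $t\in\mathbb R$, $e^{-itH}D(T)\subset D(T)$ and $Te^{-itH}\psi=e^{-itH}(T+t)\psi$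 for all $\psi\in D(T)$. More precisely, let $\phi$ be any regular cyclic vector of $H$, and let $W_\phi=\rho_\phi'/\rho_\phi$ where $\rho_\phi>0$ and $W_\phi=0$ where $\rho_\phi=0$. Then $$Y=i\frac{d}{d\lambda}+\frac i2W_\phi,\qquad D(Y)=\text{linear hull of }\{e^{it\lambda} : t\in\mathbb R\},$$ is a well-defined operator in $L^2(\mathbb R,d\mu_\phi)$, and there is a unitary operator $V:\mathcal H\to L^2(\mathbb R,d\mu_\phi)$ such that $V\phi=1$, $VHV^{-1}$ is the operator of multiplication by $\lambda$ (with its maximal domain), and $V^{-1}YV$ is a strong time operator of $H$. -/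

import Mathlib

open MeasureTheory Filter Topology
open scoped ENNReal InnerProductSpace

namespace TimeOp

variable {ℋ : Type*} [NormedAddCommGroup ℋ] [InnerProductSpace ℂ ℋ] [CompleteSpace ℋ]

/-- A projection-valued measure on the Borel sets of `ℝ`: a strongly countably additive family of
orthogonal projections with `E ∅ = 0`, `E ℝ = 1` and `E (A ∩ B) = E A * E B`.
Only the values on Borel sets matter. -/
structure PVM (ℋ : Type*) [NormedAddCommGroup ℋ] [InnerProductSpace ℂ ℋ] [CompleteSpace ℋ] where
  proj : Set ℝ → (ℋ →L[ℂ] ℋ)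
  isProj : ∀ B, MeasurableSet B → IsStarProjection (proj B)
  empty : proj ∅ = 0
  univ : proj Set.univ = 1
  inter : ∀ A B, MeasurableSet A → MeasurableSet B → proj (A ∩ B) = proj A * proj B
  hasSum : ∀ B : ℕ → Set ℝ, (∀ n, MeasurableSet (B n)) → Pairwise (Function.onFun Disjoint B) →
    ∀ ψ, HasSum (fun n => proj (B n) ψ) (proj (⋃ n, B n) ψ)

theorem PVM.norm_sq (E : PVM ℋ) {B : Set ℝ} (hB : MeasurableSet B) (ψ : ℋ) :
    ‖E.proj B ψ‖ ^ 2 = (⟪ψ, E.proj B ψ⟫_ℂ).re := by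
  have h := E.isProj B hB
  have h1 : E.proj B (E.proj B ψ) = E.proj B ψ := by
    have := congrArg (fun A : ℋ →L[ℂ] ℋ => A ψ) h.isIdempotentElem.eq
    simpa using this
  have h2 : ⟪E.proj B ψ, E.proj B ψ⟫_ℂ = ⟪ψ, E.proj B ψ⟫_ℂ := by
    have h3 := ContinuousLinearMap.adjoint_inner_right (E.proj B) ψ (E.proj B ψ)
    rw [← ContinuousLinearMap.star_eq_adjoint, h.isSelfAdjoint.star_eq, h1] at h3
    exact h3.symm
  rw [← h2, inner_self_eq_norm_sq_to_K]
  norm_cast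

/-- The finite Borel measure `μ_ψ(B) = ‖E(B)ψ‖²`. -/
noncomputable def PVM.vecMeasure (E : PVM ℋ) (ψ : ℋ) : Measure ℝ :=
  Measure.ofMeasurable (fun B _ => ENNReal.ofReal (‖E.proj B ψ‖ ^ 2))
    (by simp [E.empty])
    (by
      intro B hB hd
      have hs : HasSum (fun n => ‖E.proj (B n) ψ‖ ^ 2) (‖E.proj (⋃ n, B n) ψ‖ ^ 2) := by
        have h := E.hasSum B hB hd ψ
        have h1 := Complex.hasSum_re ((innerSL ℂ ψ).hasSum h)
        rw [E.norm_sq (MeasurableSet.iUnion hB)]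
        simp_rw [fun n => E.norm_sq (hB n) ψ]
        simpa using h1
      rw [← hs.tsum_eq]
      exact ENNReal.ofReal_tsum_of_nonneg (fun n => sq_nonneg _) hs.summable)

/-- The point mass at `0` with full projection, used only as a default value. -/
noncomputable def PVM.diracZero (ℋ : Type*) [NormedAddCommGroup ℋ] [InnerProductSpace ℂ ℋ]
    [CompleteSpace ℋ] : PVM ℋ := by
  classical
  exact
  { proj := fun B => if (0 : ℝ) ∈ B then 1 else 0
    isProj := by
      intro B _
      split_ifs
      · exact ⟨IsIdempotentElem.one, IsSelfAdjoint.one _⟩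
      · exact ⟨IsIdempotentElem.zero, IsSelfAdjoint.zero _⟩
    empty := by simp
    univ := by simp
    inter := by
      intro A B _ _
      by_cases hA : (0 : ℝ) ∈ A <;> by_cases hB : (0 : ℝ) ∈ B <;> simp [hA, hB]
    hasSum := by
      intro B _ hd ψ
      by_cases h : (0 : ℝ) ∈ ⋃ n, B n
      · obtain ⟨n, hn⟩ := Set.mem_iUnion.1 h
        have h2 := hasSum_single (f := fun m =>
          (if (0 : ℝ) ∈ B m then (1 : ℋ →L[ℂ] ℋ) else 0) ψ) n (by
            intro m hm
            have : (0 : ℝ) ∉ B m := fun h' => Set.disjoint_left.1 (hd hm) h' hn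
            simp [this])
        simpa [hn, h] using h2
      · have h' : ∀ n, (0 : ℝ) ∉ B n := fun n hn => h (Set.mem_iUnion.2 ⟨n, hn⟩)
        rw [if_neg h]
        simp only [h', if_false]
        exact hasSum_zero }

/-- `H = ∫ λ dE(λ)`: the domain of `H` consists of the `ψ` with `∫ λ² dμ_ψ < ∞`, and
`⟨ψ, Hψ⟩ = ∫ λ dμ_ψ` there. -/
def IsSpectralMeasure (H : ℋ →ₗ.[ℂ] ℋ) (E : PVM ℋ) : Prop :=
  (∀ ψ : ℋ, ψ ∈ H.domain ↔ Integrable (fun x : ℝ => x ^ 2) (E.vecMeasure ψ)) ∧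
  ∀ ψ : H.domain, ⟪(ψ : ℋ), H ψ⟫_ℂ = ((∫ x, x ∂(E.vecMeasure (ψ : ℋ)) : ℝ) : ℂ)

open Classical in
/-- The spectral measure `E_H`. For a self-adjoint `H` the projection-valued measure with
`H = ∫ λ dE(λ)` exists and is unique on Borel sets; the default value concerns other `H` only. -/
noncomputable def spectralMeasure (H : ℋ →ₗ.[ℂ] ℋ) : PVM ℋ :=
  if h : ∃ E : PVM ℋ, IsSpectralMeasure H E then h.choose else PVM.diracZero ℋ

/-- `μ_ψ(B) = ‖E_H(B)ψ‖²`. -/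
noncomputable def specMeas (H : ℋ →ₗ.[ℂ] ℋ) (ψ : ℋ) : Measure ℝ :=
  (spectralMeasure H).vecMeasure ψ

/-- `A = f(H) = ∫ f dE_H` for a bounded Borel function `f`; by polarization at most one bounded
operator has this property. -/
def IsFunCalc (H : ℋ →ₗ.[ℂ] ℋ) (f : ℝ → ℂ) (A : ℋ →L[ℂ] ℋ) : Prop :=
  ∀ ψ : ℋ, ⟪ψ, A ψ⟫_ℂ = ∫ x, f x ∂(specMeas H ψ)

/-- A (densely defined) symmetric operator. -/
def IsSymmetricOp (T : ℋ →ₗ.[ℂ] ℋ) : Prop :=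
  Dense (T.domain : Set ℋ) ∧ T.IsFormalAdjoint T

/-- `(A, B)` is a weak Weyl representation: `A` is self-adjoint, `B` is symmetric,
`e^{-itA} D(B) ⊆ D(B)` and `B e^{-itA} ψ = e^{-itA} (B + t) ψ` for all `ψ ∈ D(B)`, `t ∈ ℝ`.
Here `U t` is the operator `e^{-itA}`. -/
def IsWeakWeyl (A B : ℋ →ₗ.[ℂ] ℋ) : Prop :=
  IsSelfAdjoint A ∧ IsSymmetricOp B ∧
  ∃ U : ℝ → (ℋ →L[ℂ] ℋ),
    (∀ t : ℝ, IsFunCalc A (fun x => Complex.exp (-(Complex.I * t * x))) (U t)) ∧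
    ∀ (t : ℝ) (ψ : B.domain), ∃ h : U t (ψ : ℋ) ∈ B.domain,
      B ⟨U t (ψ : ℋ), h⟩ = U t (B ψ + (t : ℂ) • (ψ : ℋ))

/-- `T` is a strong time operator of `H`. -/
def IsStrongTimeOperator (H T : ℋ →ₗ.[ℂ] ℋ) : Prop := IsWeakWeyl H T

/-- `φ` is a nonzero vector in the domains of all powers of `H` (`x n = Hⁿφ`) and the linear hull
of the vectors `Hⁿφ` is dense. -/
def IsCyclicVector (H : ℋ →ₗ.[ℂ] ℋ) (φ : ℋ) : Prop :=
  φ ≠ 0 ∧ ∃ x : ℕ → H.domain, (x 0 : ℋ) = φ ∧ (∀ n, (x (n + 1) : ℋ) = H (x n)) ∧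
    Dense (Submodule.span ℂ (Set.range fun n => (x n : ℋ)) : Set ℋ)

/-- Every `μ_ψ` is absolutely continuous with respect to Lebesgue measure. -/
def IsAbsCont (H : ℋ →ₗ.[ℂ] ℋ) : Prop := ∀ ψ : ℋ, specMeas H ψ ≪ volume

/-- `φ` is a cyclic vector for `H`, and `ρ` is a density of `μ_φ` that is differentiable on `ℝ`,
vanishes at `±∞` and has finite Fisher information. -/
structure IsRegularCyclic (H : ℋ →ₗ.[ℂ] ℋ) (φ : ℋ) (ρ : ℝ → ℝ) : Prop where
  cyclic : IsCyclicVector H φ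
  nonneg : ∀ x, 0 ≤ ρ x
  density : specMeas H φ = volume.withDensity fun x => ENNReal.ofReal (ρ x)
  differentiable : Differentiable ℝ ρ
  tendsto_atTop : Tendsto ρ atTop (𝓝 0)
  tendsto_atBot : Tendsto ρ atBot (𝓝 0)
  fisher : IntegrableOn (fun x => deriv ρ x ^ 2 / ρ x) {x | 0 < ρ x} volume

/-- The class `S₀(ℋ)` of self-adjoint operators. -/
structure InS0 (H : ℋ →ₗ.[ℂ] ℋ) : Prop where
  selfAdjoint : IsSelfAdjoint H
  absCont : IsAbsCont H
  exists_cyclic : ∃ (φ : ℋ) (ρ : ℝ → ℝ), IsRegularCyclic H φ ρ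

open Classical in
/-- `W = ρ'/ρ` where `ρ > 0`, and `0` where `ρ = 0`. -/
noncomputable def logSlope (ρ : ℝ → ℝ) (x : ℝ) : ℝ :=
  if 0 < ρ x then deriv ρ x / ρ x else 0

/-- The linear hull of the functions `λ ↦ e^{itλ}`, `t ∈ ℝ`. -/
noncomputable def expSpan : Submodule ℂ (ℝ → ℂ) :=
  Submodule.span ℂ (Set.range fun t : ℝ => fun x : ℝ => Complex.exp (Complex.I * t * x))

theorem differentiable_of_mem_expSpan {F : ℝ → ℂ} (hF : F ∈ expSpan) : Differentiable ℝ F := by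
  unfold expSpan at hF
  induction hF using Submodule.span_induction with
  | mem F h =>
    obtain ⟨t, rfl⟩ := h
    intro x
    have h1 : HasDerivAt (fun y : ℝ => (y : ℂ)) 1 x := Complex.ofRealCLM.hasDerivAt
    exact ((h1.const_mul (Complex.I * t)).cexp).differentiableAt
  | zero => exact differentiable_const 0
  | add F G _ _ hF hG => exact hF.add hG
  | smul c F _ hF => exact hF.const_smul c

/-- The graph of `i d/dλ + (i/2) W` on the linear hull of the `e^{itλ}`, in `L²(μ)`: the pairs
`(F, i F' + (i/2) W F)` of classes in `L²(μ)`, with `F` in that linear hull. -/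
noncomputable def timeGraph (μ : Measure ℝ) (ρ : ℝ → ℝ) :
    Submodule ℂ (Lp ℂ 2 μ × Lp ℂ 2 μ) where
  carrier := {p | ∃ F ∈ expSpan, (p.1 : ℝ → ℂ) =ᵐ[μ] F ∧
    (p.2 : ℝ → ℂ) =ᵐ[μ] fun x =>
      Complex.I * deriv F x + Complex.I / 2 * (logSlope ρ x : ℂ) * F x}
  zero_mem' := by
    refine ⟨0, Submodule.zero_mem _, Lp.coeFn_zero _ _ _, ?_⟩
    filter_upwards [Lp.coeFn_zero ℂ 2 μ] with x hx
    simpa using hx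
  add_mem' := by
    rintro p q ⟨F, hF, hp1, hp2⟩ ⟨G, hG, hq1, hq2⟩
    refine ⟨F + G, Submodule.add_mem _ hF hG, ?_, ?_⟩
    · exact (Lp.coeFn_add p.1 q.1).trans (hp1.add hq1)
    · filter_upwards [Lp.coeFn_add p.2 q.2, hp2, hq2] with x h hp hq
      have hd : deriv (F + G) x = deriv F x + deriv G x :=
        deriv_add (differentiable_of_mem_expSpan hF x) (differentiable_of_mem_expSpan hG x)
      simp only [Prod.snd_add, h, Pi.add_apply, hp, hq, hd]
      ring
  smul_mem' := by
    rintro c p ⟨F, hF, hp1, hp2⟩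
    refine ⟨c • F, Submodule.smul_mem _ c hF, ?_, ?_⟩
    · exact (Lp.coeFn_smul c p.1).trans (hp1.const_smul c)
    · filter_upwards [Lp.coeFn_smul c p.2, hp2] with x h hp
      have hd : deriv (c • F) x = c • deriv F x :=
        deriv_const_smul c (differentiable_of_mem_expSpan hF x)
      simp only [Prod.smul_snd, h, Pi.smul_apply, hp, hd, smul_eq_mul]
      ring

/-- The operator `Y = i d/dλ + (i/2) W` in `L²(μ)` with domain the linear hull of the `e^{itλ}`. -/
noncomputable def timeOp (μ : Measure ℝ) (ρ : ℝ → ℝ) : Lp ℂ 2 μ →ₗ.[ℂ] Lp ℂ 2 μ :=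
  (timeGraph μ ρ).toLinearPMap

/-- The maximal multiplication operator `M_X` by `X(λ) = λ` in `L²(μ)`. -/
noncomputable def mulX (μ : Measure ℝ) : Lp ℂ 2 μ →ₗ.[ℂ] Lp ℂ 2 μ where
  domain :=
    { carrier := {f | MemLp (fun x : ℝ => (x : ℂ) * f x) 2 μ}
      zero_mem' := by
        refine (MemLp.zero' (ε := ℂ) (p := 2) (μ := μ)).ae_eq ?_
        filter_upwards [Lp.coeFn_zero ℂ 2 μ] with x hx
        rw [hx]
        simp
      add_mem' := by
        intro f g hf hg
        refine (MemLp.add hf hg).ae_eq ?_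
        filter_upwards [Lp.coeFn_add f g] with x hx
        have hx' : (x : ℂ) * (f x + g x) = x * f x + x * g x := mul_add _ _ _
        rw [hx]
        exact hx'.symm
      smul_mem' := by
        intro c f hf
        refine (MemLp.const_smul hf c).ae_eq ?_
        filter_upwards [Lp.coeFn_smul c f] with x hx
        simp [hx, mul_left_comm] }
  toFun :=
    { toFun := fun f => MemLp.toLp _ f.2
      map_add' := by
        intro f g
        rw [← MemLp.toLp_add]
        refine MemLp.toLp_congr _ _ ?_
        filter_upwards [Lp.coeFn_add (f : Lp ℂ 2 μ) g] with x hx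
        change (x : ℂ) * ((f : Lp ℂ 2 μ) + (g : Lp ℂ 2 μ) : Lp ℂ 2 μ) x = _
        rw [hx]
        exact mul_add _ _ _
      map_smul' := by
        intro c f
        rw [RingHom.id_apply, ← MemLp.toLp_const_smul]
        refine MemLp.toLp_congr _ _ ?_
        filter_upwards [Lp.coeFn_smul c (f : Lp ℂ 2 μ)] with x hx
        simp [hx, mul_left_comm] }

/-- The operator `V⁻¹ S V`, with domain `V⁻¹ D(S)`, for a unitary `V`. -/
def pullback {𝒦 : Type*} [NormedAddCommGroup 𝒦] [InnerProductSpace ℂ 𝒦]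
    (V : ℋ ≃ₗᵢ[ℂ] 𝒦) (S : 𝒦 →ₗ.[ℂ] 𝒦) : ℋ →ₗ.[ℂ] ℋ where
  domain := S.domain.comap (V.toLinearEquiv : ℋ →ₗ[ℂ] 𝒦)
  toFun :=
    { toFun := fun ψ => V.symm (S ⟨V ψ, ψ.2⟩)
      map_add' := by
        intro a b
        rw [← map_add V.symm, ← LinearPMap.map_add]
        congr 2
        ext
        simp
      map_smul' := by
        intro c a
        rw [RingHom.id_apply, ← map_smul V.symm, ← LinearPMap.map_smul]
        congr 2
        ext
        simp }

end TimeOp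

/-! Let `μ = μ_φ = ρ dλ` and `W = ρ'/ρ`. For exponential sums `F`, `G` one has `(ρ F̄ G)' = ρ (F̄' G
+ F̄ G' + W F̄ G)`, and the boundary terms vanish because `ρ → 0` while `F`, `G` are bounded. Hence
`i d/dλ` fails to be symmetric in `L²(μ)` by exactly `-i ∫ W F̄ G dμ`, and adding `(i/2) W` repairs
this (`integral_deriv_mul_eq_zero`, `timeGraph_symmetric`). Finite Fisher information says that `W ∈
L²(μ)`, so `Y` has values in `L²(μ)`. It is well defined because a continuous `F` vanishing `μ`-a.e.
vanishes on the open set `{ρ > 0}`, and so does `F'`. Its domain is dense because characteristic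
functions determine finite measures. The Weyl relation is the product rule: `i (e^{-itλ})' = t
e^{-itλ}`.

The transfer to `ℋ` is `J f = f(H) φ`, the isometry of `L²(μ)` prescribed by `1_B ↦ E_H(B) φ`. It
intertwines indicators with spectral projections, so `dμ_{J f} = |f|² dμ`, and it carries
multiplication by `λ` to `H` (`Intertwines.apply_eq`). Its range is closed and contains every `Hⁿφ`,
so cyclicity makes it onto; `V` is its inverse.

Since `E_H` is chosen among the spectral measures of `H`, one must be shown to exist
(`exists_isSpectralMeasure`). The resolvent `R = (H + i)⁻¹` is bounded and normal; its continuous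
functional calculus at `φ` and the Riesz representation theorem turn it into multiplication by `z`
in an `L²(ν)` over its spectrum. The resolvent identity forces `Im z⁻¹ = 1`, so `H` becomes
multiplication by the real function `Re z⁻¹`, and the indicators of its level sets give the
projections. -/

namespace TimeOp

/-! ### Isometries from Gram matrices, and polarization -/

section Hilbert

variable {X Y : Type*} [NormedAddCommGroup X] [InnerProductSpace ℂ X]
  [NormedAddCommGroup Y] [InnerProductSpace ℂ Y]

/-- Two families of vectors with the same Gram matrix are related by an isometry, defined on the
whole space if the first family is total. -/
theorem exists_linearIsometry_of_inner_eq [CompleteSpace Y] {ι : Type*} (v : ι → X) (w : ι → Y)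
    (hd : Dense (Submodule.span ℂ (Set.range v) : Set X))
    (h : ∀ i j, ⟪v i, v j⟫_ℂ = ⟪w i, w j⟫_ℂ) :
    ∃ J : X →ₗᵢ[ℂ] Y, ∀ i, J (v i) = w i := by
  set A := Finsupp.linearCombination ℂ v with hA
  set B := Finsupp.linearCombination ℂ w with hB
  have hdr : DenseRange A := by
    have : Set.range A = (Submodule.span ℂ (Set.range v) : Set X) := by
      rw [← Finsupp.range_linearCombination]; rfl
    rw [DenseRange, this]
    exact hd
  -- Equal Gram matrices give equal norms of all finite combinations, so `A c ↦ B c` is well defined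
  -- and isometric on a dense subspace.
  have hnorm : ∀ c, ‖B c‖ = ‖A c‖ := by
    intro c
    have : ⟪B c, B c⟫_ℂ = ⟪A c, A c⟫_ℂ := by
      simp only [hA, hB, Finsupp.linearCombination_apply, Finsupp.sum, inner_sum, sum_inner,
        inner_smul_left, inner_smul_right, h]
    rw [@norm_eq_sqrt_re_inner ℂ, @norm_eq_sqrt_re_inner ℂ, this]
  have hb : ∃ C : ℝ, ∀ c, ‖B c‖ ≤ C * ‖A c‖ := ⟨1, fun c => by rw [hnorm, one_mul]⟩
  refine ⟨⟨(B.extendOfNorm A).toLinearMap, fun x => ?_⟩, fun i => ?_⟩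
  · refine hdr.induction_on (p := fun x => ‖(B.extendOfNorm A) x‖ = ‖x‖) x ?_ fun c => ?_
    · exact isClosed_eq (B.extendOfNorm A).continuous.norm continuous_norm
    · rw [LinearMap.extendOfNorm_eq hdr hb, hnorm]
  · have := LinearMap.extendOfNorm_eq hdr hb (Finsupp.single i 1)
    simpa [hA, hB] using this

/-- Polarization for a form `⟪i x, A y⟫` on a complex vector space. -/
theorem inner_eq_zero_of_forall_inner_self {M : Type*} [AddCommGroup M] [Module ℂ M]
    (i A : M →ₗ[ℂ] X) (h : ∀ x, ⟪i x, A x⟫_ℂ = 0) (x y : M) : ⟪i x, A y⟫_ℂ = 0 := by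
  -- The vectors `x + y` and `x + iy` give `a + b = 0` and `i a - i b = 0` for the two mixed terms
  -- `a`, `b`.
  have h1 := h (x + y)
  have h2 := h (x + Complex.I • y)
  simp only [map_add, map_smul, inner_add_left, inner_add_right, inner_smul_left,
    inner_smul_right, h, Complex.conj_I] at h1 h2
  have h3 : ⟪i y, A x⟫_ℂ = - ⟪i x, A y⟫_ℂ := by linear_combination h1
  rw [h3] at h2
  have h4 : (2 * Complex.I) * ⟪i x, A y⟫_ℂ = 0 := by linear_combination h2
  simpa using h4

end Hilbert

/-! ### Multiplication operators in `L²(μ)` -/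

section Multiplication

variable {α : Type*} [MeasurableSpace α] {μ : Measure α}

/-- The bounded operator of multiplication by an essentially bounded function in `L²(μ)`. -/
noncomputable def mulOp (m : α → ℂ) (hm : MemLp m ∞ μ) : Lp ℂ 2 μ →L[ℂ] Lp ℂ 2 μ :=
  (ContinuousLinearMap.mul ℂ ℂ).holderL μ ∞ 2 2 (hm.toLp m)

theorem coeFn_mulOp (m : α → ℂ) (hm : MemLp m ∞ μ) (f : Lp ℂ 2 μ) :
    mulOp m hm f =ᵐ[μ] fun x => m x * f x := by
  filter_upwards [(ContinuousLinearMap.mul ℂ ℂ).coeFn_holder (r := 2) (hm.toLp m) f,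
    hm.coeFn_toLp] with x h1 h2
  rw [← h2]
  exact h1

theorem inner_mulOp (m : α → ℂ) (hm : MemLp m ∞ μ) (f g : Lp ℂ 2 μ) :
    ⟪f, mulOp m hm g⟫_ℂ = ∫ x, m x * ⟪f x, g x⟫_ℂ ∂μ := by
  rw [L2.inner_def]
  refine integral_congr_ae ?_
  filter_upwards [coeFn_mulOp m hm g] with x hx
  rw [hx, ← smul_eq_mul (m x) (g x), inner_smul_right]

theorem memLp_indicator_one {B : Set α} (hB : MeasurableSet B) :
    MemLp (B.indicator (1 : α → ℂ)) ∞ μ :=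
  (memLp_top_const (1 : ℂ)).indicator hB

theorem coeFn_mulOp_indicator {B : Set α} (hB : MeasurableSet B) (f : Lp ℂ 2 μ) :
    mulOp _ (memLp_indicator_one hB) f =ᵐ[μ] B.indicator f := by
  filter_upwards [coeFn_mulOp _ (memLp_indicator_one hB) f] with x hx
  rw [hx]
  by_cases h : x ∈ B <;> simp [h]

theorem enorm_sq_eq_lintegral (f : Lp ℂ 2 μ) : ‖f‖ₑ ^ 2 = ∫⁻ x, ‖f x‖ₑ ^ 2 ∂μ := by
  rw [Lp.enorm_def, eLpNorm_eq_lintegral_rpow_enorm_toReal (by simp) (by simp),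
    ← ENNReal.rpow_natCast, ← ENNReal.rpow_mul]
  simp

theorem enorm_sq_mulOp_indicator {B : Set α} (hB : MeasurableSet B) (f : Lp ℂ 2 μ) :
    ‖mulOp _ (memLp_indicator_one hB) f‖ₑ ^ 2 = ∫⁻ x in B, ‖f x‖ₑ ^ 2 ∂μ := by
  rw [enorm_sq_eq_lintegral, ← lintegral_indicator hB]
  refine lintegral_congr_ae ?_
  filter_upwards [coeFn_mulOp_indicator hB f] with x hx
  rw [hx]
  by_cases h : x ∈ B <;> simp [h]

/-- Serves the integral formulas for `withDensity` that take a density with values in `NNReal`. -/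
theorem withDensity_enorm_sq (f : Lp ℂ 2 μ) :
    (μ.withDensity fun x => ‖f x‖ₑ ^ 2) =
      μ.withDensity fun x => ((‖f x‖₊ ^ 2 : NNReal) : ℝ≥0∞) := by
  congr 1

theorem dense_span_indicator [IsFiniteMeasure μ] :
    Dense (Submodule.span ℂ (Set.range fun B : {B : Set α // MeasurableSet B} =>
      indicatorConstLp (μ := μ) 2 B.2 (measure_ne_top μ _) (1 : ℂ)) : Set (Lp ℂ 2 μ)) := by
  set S := Submodule.span ℂ (Set.range fun B : {B : Set α // MeasurableSet B} =>
      indicatorConstLp (μ := μ) 2 B.2 (measure_ne_top μ _) (1 : ℂ))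
  intro f
  refine Lp.induction (p := 2) (by simp) (fun f => f ∈ closure (S : Set (Lp ℂ 2 μ))) ?_ ?_ ?_ f
  · intro c s hs hμ
    refine subset_closure ?_
    have : (Lp.simpleFunc.indicatorConst 2 hs hμ.ne c : Lp ℂ 2 μ) =
        c • indicatorConstLp 2 hs (measure_ne_top μ s) (1 : ℂ) := by
      rw [Lp.simpleFunc.coe_indicatorConst]
      apply Lp.ext
      filter_upwards [indicatorConstLp_coeFn (p := 2) (hs := hs) (hμs := hμ.ne) (c := c),
        Lp.coeFn_smul c (indicatorConstLp (μ := μ) 2 hs (measure_ne_top μ s) (1 : ℂ)),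
        indicatorConstLp_coeFn (p := 2) (hs := hs) (hμs := measure_ne_top μ s) (c := (1 : ℂ))]
        with x h1 h2 h3
      rw [h1, h2, Pi.smul_apply, h3]
      by_cases h : x ∈ s <;> simp [h]
    rw [this]
    exact S.smul_mem c (Submodule.subset_span ⟨⟨s, hs⟩, rfl⟩)
  · intro f g hf hg _ h1 h2
    rw [← Submodule.topologicalClosure_coe] at h1 h2 ⊢
    exact Submodule.add_mem _ h1 h2
  · exact isClosed_closure

end Multiplication

/-! ### Projection-valued measures and the isometry of a vector -/

section PVM

variable {ℋ : Type*} [NormedAddCommGroup ℋ] [InnerProductSpace ℂ ℋ] [CompleteSpace ℋ]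
  (E : PVM ℋ)

theorem PVM.vecMeasure_apply {B : Set ℝ} (hB : MeasurableSet B) (ψ : ℋ) :
    E.vecMeasure ψ B = ‖E.proj B ψ‖ₑ ^ 2 := by
  rw [vecMeasure, Measure.ofMeasurable_apply B hB, ENNReal.ofReal_pow (norm_nonneg _),
    ofReal_norm]

instance PVM.isFiniteMeasure_vecMeasure (ψ : ℋ) : IsFiniteMeasure (E.vecMeasure ψ) := by
  refine ⟨?_⟩
  rw [E.vecMeasure_apply MeasurableSet.univ]
  exact ENNReal.pow_lt_top enorm_lt_top

theorem PVM.inner_proj_left {B : Set ℝ} (hB : MeasurableSet B) (ψ η : ℋ) :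
    ⟪E.proj B ψ, η⟫_ℂ = ⟪ψ, E.proj B η⟫_ℂ := by
  have h := ContinuousLinearMap.adjoint_inner_right (E.proj B) ψ η
  rw [← ContinuousLinearMap.star_eq_adjoint, (E.isProj B hB).isSelfAdjoint.star_eq] at h
  exact h.symm

theorem PVM.proj_proj {A B : Set ℝ} (hA : MeasurableSet A) (hB : MeasurableSet B) (ψ : ℋ) :
    E.proj A (E.proj B ψ) = E.proj (A ∩ B) ψ := by
  rw [E.inter A B hA hB]
  rfl

theorem PVM.inner_proj_self {B : Set ℝ} (hB : MeasurableSet B) (ψ : ℋ) :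
    ⟪ψ, E.proj B ψ⟫_ℂ = ((E.vecMeasure ψ).real B : ℂ) := by
  have h : ⟪ψ, E.proj B ψ⟫_ℂ = ⟪E.proj B ψ, E.proj B ψ⟫_ℂ := by
    rw [E.inner_proj_left hB, E.proj_proj hB hB, Set.inter_self]
  rw [h, inner_self_eq_norm_sq_to_K, measureReal_def, E.vecMeasure_apply hB, ENNReal.toReal_pow,
    toReal_enorm]
  norm_cast

/-- `J` intertwines multiplication by indicator functions and the projections of `E`. -/
def Intertwines {μ : Measure ℝ} (E : PVM ℋ) (J : Lp ℂ 2 μ →ₗᵢ[ℂ] ℋ) : Prop :=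
  ∀ (B : Set ℝ) (hB : MeasurableSet B) (f : Lp ℂ 2 μ),
    E.proj B (J f) = J (mulOp _ (memLp_indicator_one hB) f)

/-- The isometry `f ↦ f(H) φ` of `L²(μ_φ)` into the Hilbert space; it intertwines multiplication
by indicator functions and the spectral projections. -/
theorem PVM.exists_isometry (φ : ℋ) :
    ∃ J : Lp ℂ 2 (E.vecMeasure φ) →ₗᵢ[ℂ] ℋ,
      (∀ f : Lp ℂ 2 (E.vecMeasure φ), f =ᵐ[E.vecMeasure φ] (fun _ => (1 : ℂ)) → J f = φ) ∧
      Intertwines E J := by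
  set μ := E.vecMeasure φ with hμ
  obtain ⟨J, hJ⟩ := exists_linearIsometry_of_inner_eq
    (fun B : {B : Set ℝ // MeasurableSet B} =>
      indicatorConstLp (μ := μ) 2 B.2 (measure_ne_top μ _) (1 : ℂ))
    (fun B => E.proj B.1 φ) dense_span_indicator (by
      -- Both Gram matrices have the entry `μ (A ∩ B)`.
      rintro ⟨A, hA⟩ ⟨B, hB⟩
      dsimp only
      rw [L2.inner_indicatorConstLp_one hA, E.inner_proj_left hA, E.proj_proj hA hB,
        E.inner_proj_self (hA.inter hB),
        integral_congr_ae (ae_restrict_of_ae indicatorConstLp_coeFn), integral_indicator hB]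
      simp [Measure.restrict_restrict hB, Set.inter_comm, measureReal_def, hμ])
  refine ⟨J, fun f hf => ?_, fun B hB f => ?_⟩
  · have h1 : f = indicatorConstLp (μ := μ) 2 MeasurableSet.univ (measure_ne_top μ _) (1 : ℂ) := by
      apply Lp.ext
      filter_upwards [hf, indicatorConstLp_coeFn (μ := μ) (p := 2) (hs := MeasurableSet.univ)
        (hμs := measure_ne_top μ _) (c := (1 : ℂ))] with x h1 h2
      rw [h1, h2]
      simp
    rw [h1, hJ ⟨Set.univ, MeasurableSet.univ⟩, E.univ]
    rfl
  -- Two bounded operators are compared on indicators, where `1_B 1_A = 1_{B ∩ A}` matches `E(B)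
  -- E(A) = E(B ∩ A)`.
  · have key : Set.EqOn ((E.proj B).comp J.toContinuousLinearMap)
        (J.toContinuousLinearMap.comp (mulOp _ (memLp_indicator_one hB)))
        (Set.range fun B : {B : Set ℝ // MeasurableSet B} =>
          indicatorConstLp (μ := μ) 2 B.2 (measure_ne_top μ _) (1 : ℂ)) := by
      rintro _ ⟨⟨A, hA⟩, rfl⟩
      have h1 : mulOp _ (memLp_indicator_one hB)
          (indicatorConstLp (μ := μ) 2 hA (measure_ne_top μ _) (1 : ℂ)) =
          indicatorConstLp (μ := μ) 2 (hB.inter hA) (measure_ne_top μ _) (1 : ℂ) := by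
        apply Lp.ext
        filter_upwards [coeFn_mulOp_indicator hB
            (indicatorConstLp (μ := μ) 2 hA (measure_ne_top μ _) (1 : ℂ)),
          indicatorConstLp_coeFn (μ := μ) (p := 2) (hs := hA)
            (hμs := measure_ne_top μ _) (c := (1 : ℂ)),
          indicatorConstLp_coeFn (μ := μ) (p := 2) (hs := hB.inter hA)
            (hμs := measure_ne_top μ _) (c := (1 : ℂ))] with x h1 h2 h3
        rw [h1, h3, ← Set.indicator_indicator]
        by_cases h : x ∈ B <;> simp [h, h2]
      have h2 := hJ ⟨A, hA⟩
      have h3 := hJ ⟨B ∩ A, hB.inter hA⟩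
      dsimp only at h2 h3
      simp only [ContinuousLinearMap.comp_apply, LinearIsometry.coe_toContinuousLinearMap]
      rw [h1, h2, h3, E.proj_proj hB hA]
    exact congrArg (fun A : Lp ℂ 2 μ →L[ℂ] ℋ => A f)
      (ContinuousLinearMap.ext_on dense_span_indicator key)

end PVM

/-! ### Spectral measures and the form of `H` through an intertwining isometry -/

section Intertwining

variable {ℋ : Type*} [NormedAddCommGroup ℋ] [InnerProductSpace ℂ ℋ] [CompleteSpace ℋ]
  {E : PVM ℋ} {μ : Measure ℝ}

variable {J : Lp ℂ 2 μ →ₗᵢ[ℂ] ℋ}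

/-- `E(B) J f = J (1_B f)` has squared norm `∫_B |f|² dμ`. This turns questions about spectral
measures on the range of `J` into integrals against `μ`. -/
theorem Intertwines.vecMeasure_eq (hJ : Intertwines E J) (f : Lp ℂ 2 μ) :
    E.vecMeasure (J f) = μ.withDensity fun x => ‖f x‖ₑ ^ 2 := by
  ext B hB
  rw [E.vecMeasure_apply hB, hJ B hB, J.enorm_map, enorm_sq_mulOp_indicator hB,
    withDensity_apply _ hB]

theorem Intertwines.integral_vecMeasure (hJ : Intertwines E J) (f : Lp ℂ 2 μ) {F : Type*}
    [NormedAddCommGroup F] [NormedSpace ℝ F] (g : ℝ → F) :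
    ∫ x, g x ∂(E.vecMeasure (J f)) = ∫ x, (‖f x‖ ^ 2) • g x ∂μ := by
  rw [hJ.vecMeasure_eq, withDensity_enorm_sq,
    integral_withDensity_eq_integral_smul₀ (by
      exact ((Lp.stronglyMeasurable f).measurable.nnnorm.pow_const 2).aemeasurable)]
  rfl

theorem Intertwines.integrable_vecMeasure_iff (hJ : Intertwines E J) (f : Lp ℂ 2 μ) {F : Type*}
    [NormedAddCommGroup F] [NormedSpace ℝ F] (g : ℝ → F) :
    Integrable g (E.vecMeasure (J f)) ↔ Integrable (fun x => (‖f x‖ ^ 2) • g x) μ := by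
  rw [hJ.vecMeasure_eq, withDensity_enorm_sq,
    integrable_withDensity_iff_integrable_smul₀ (by
      exact ((Lp.stronglyMeasurable f).measurable.nnnorm.pow_const 2).aemeasurable)]
  rfl

variable {H : ℋ →ₗ.[ℂ] ℋ}

/-- Both conditions say `∫ x² |f|² dμ < ∞`. -/
theorem Intertwines.mem_domain_iff (hJ : Intertwines E J) (hE : IsSpectralMeasure H E)
    (f : Lp ℂ 2 μ) : J f ∈ H.domain ↔ f ∈ (mulX μ).domain := by
  have hm : AEStronglyMeasurable (fun x : ℝ => (x : ℂ) * f x) μ :=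
    Complex.continuous_ofReal.aestronglyMeasurable.mul (Lp.aestronglyMeasurable f)
  rw [hE.1, hJ.integrable_vecMeasure_iff]
  change _ ↔ MemLp (fun x : ℝ => (x : ℂ) * f x) 2 μ
  rw [memLp_two_iff_integrable_sq_norm hm]
  refine integrable_congr (.of_forall fun x => ?_)
  simp [mul_pow, mul_comm]

theorem coeFn_mulX (f : (mulX μ).domain) :
    mulX μ f =ᵐ[μ] fun x => (x : ℂ) * (f : Lp ℂ 2 μ) x :=
  MemLp.coeFn_toLp f.2

/-- The quadratic form of multiplication by `x`. -/
theorem inner_mulX_self (f : (mulX μ).domain) :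
    ⟪(f : Lp ℂ 2 μ), mulX μ f⟫_ℂ = ((∫ x, ‖(f : Lp ℂ 2 μ) x‖ ^ 2 * x ∂μ : ℝ) : ℂ) := by
  rw [L2.inner_def, ← integral_complex_ofReal]
  refine integral_congr_ae ?_
  filter_upwards [coeFn_mulX f] with x hx
  rw [hx, ← smul_eq_mul (x : ℂ), inner_smul_right, inner_self_eq_norm_sq_to_K]
  push_cast
  exact mul_comm _ _

/-- The form of `H` vanishes between vectors whose `E`-cyclic subspaces are orthogonal. -/
theorem IsSpectralMeasure.inner_apply_eq_zero (hE : IsSpectralMeasure H E) (η ψ : H.domain)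
    (h : ∀ B, MeasurableSet B → ⟪(η : ℋ), E.proj B ψ⟫_ℂ = 0) : ⟪(η : ℋ), H ψ⟫_ℂ = 0 := by
  -- As `E(B)ψ ⟂ E(B)η` for every `B`, Pythagoras makes the spectral measures add. So the quadratic
  -- form of `H` has no cross terms, and `c = 1` and `c = i` isolate the mixed term.
  have hm : ∀ c : ℂ, E.vecMeasure ((ψ + c • η : H.domain) : ℋ) =
      E.vecMeasure ψ + E.vecMeasure ((c • η : H.domain) : ℋ) := by
    intro c
    ext B hB
    rw [Measure.add_apply, E.vecMeasure_apply hB, E.vecMeasure_apply hB, E.vecMeasure_apply hB]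
    have h0 : ⟪E.proj B ψ, E.proj B (c • (η : ℋ))⟫_ℂ = 0 := by
      rw [map_smul, inner_smul_right, ← inner_conj_symm, E.inner_proj_left hB, E.proj_proj hB hB,
        Set.inter_self, h B hB]
      simp
    have h1 := norm_add_sq_eq_norm_sq_add_norm_sq_of_inner_eq_zero _ _ h0
    have h2 : ∀ x : ℋ, ‖x‖ₑ ^ 2 = ENNReal.ofReal (‖x‖ * ‖x‖) := fun x => by
      rw [← pow_two, ENNReal.ofReal_pow (norm_nonneg _), ofReal_norm]
    push_cast
    rw [map_add, h2, h1, ENNReal.ofReal_add (by positivity) (by positivity), h2, h2]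
  have hi : ∀ χ : H.domain, Integrable (fun x : ℝ => x) (E.vecMeasure χ) := fun χ => by
    have := (hE.1 χ).1 χ.2
    have h2 : MemLp (fun x : ℝ => x) 2 (E.vecMeasure χ) :=
      (memLp_two_iff_integrable_sq continuous_id.aestronglyMeasurable).2 this
    exact h2.integrable (by norm_num)
  have hq : ∀ c : ℂ, ⟪((ψ + c • η : H.domain) : ℋ), H (ψ + c • η)⟫_ℂ =
      ⟪(ψ : ℋ), H ψ⟫_ℂ + ⟪((c • η : H.domain) : ℋ), H (c • η)⟫_ℂ := by
    intro c
    rw [hE.2, hE.2, hE.2, hm, integral_add_measure (hi _) (hi _)]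
    push_cast
    rfl
  have h1 := hq 1
  have h2 := hq Complex.I
  simp only [LinearPMap.map_add, LinearPMap.map_smul, Submodule.coe_add, Submodule.coe_smul,
    inner_add_left, inner_add_right, inner_smul_left, inner_smul_right, Complex.conj_I,
    one_smul] at h1 h2
  have h3 : ⟪(ψ : ℋ), H η⟫_ℂ = - ⟪(η : ℋ), H ψ⟫_ℂ := by linear_combination h1
  rw [h3] at h2
  have h4 : (2 * Complex.I) * ⟪(η : ℋ), H ψ⟫_ℂ = 0 := by linear_combination -h2
  simpa using h4

end Intertwining

/-! ### The spectral representation of an operator with a cyclic vector -/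

section Representation

variable {ℋ : Type*} [NormedAddCommGroup ℋ] [InnerProductSpace ℂ ℋ] [CompleteSpace ℋ]
  {E : PVM ℋ} {μ : Measure ℝ} {J : Lp ℂ 2 μ →ₗᵢ[ℂ] ℋ} {H : ℋ →ₗ.[ℂ] ℋ}

/-- The projection onto the range of an intertwining isometry commutes with `E`. -/
theorem Intertwines.proj_comm (hJ : Intertwines E J) {B : Set ℝ} (hB : MeasurableSet B) (χ : ℋ) :
    E.proj B (J (J.toContinuousLinearMap.adjoint χ)) =
      J (J.toContinuousLinearMap.adjoint (E.proj B χ)) := by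
  rw [hJ B hB]
  congr 1
  refine ext_inner_right ℂ fun g => ?_
  rw [ContinuousLinearMap.adjoint_inner_left, LinearIsometry.coe_toContinuousLinearMap,
    E.inner_proj_left hB, hJ B hB, ← LinearIsometry.coe_toContinuousLinearMap,
    ← ContinuousLinearMap.adjoint_inner_left]
  simp only [L2.inner_def]
  refine integral_congr_ae ?_
  filter_upwards [coeFn_mulOp_indicator hB (J.toContinuousLinearMap.adjoint χ),
    coeFn_mulOp_indicator hB g] with x h1 h2
  rw [h1, h2]
  by_cases h : x ∈ B <;> simp [h]

/-- The projection `P = J J*` is contractive and commutes with `E`, so `μ_{Pχ} ≤ μ_χ`, and the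
domain is given by a finite second moment. -/
theorem Intertwines.proj_range_mem_domain (hJ : Intertwines E J) (hE : IsSpectralMeasure H E)
    {χ : ℋ} (hχ : χ ∈ H.domain) : J (J.toContinuousLinearMap.adjoint χ) ∈ H.domain := by
  rw [hE.1] at hχ ⊢
  refine hχ.mono_measure (Measure.le_iff.2 fun B hB => ?_)
  rw [E.vecMeasure_apply hB, E.vecMeasure_apply hB, hJ.proj_comm hB]
  gcongr
  rw [J.enorm_map, ← ofReal_norm, ← ofReal_norm]
  refine ENNReal.ofReal_le_ofReal ?_
  refine (ContinuousLinearMap.le_opNorm _ _).trans ?_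
  rw [LinearIsometryEquiv.norm_map]
  exact mul_le_of_le_one_left (norm_nonneg _) J.norm_toContinuousLinearMap_le

/-- An intertwining isometry carries multiplication by `x` to `H`. -/
theorem Intertwines.apply_eq (hJ : Intertwines E J) (hE : IsSpectralMeasure H E)
    (hd : Dense (H.domain : Set ℋ)) (f : (mulX μ).domain) :
    H ⟨J f, (hJ.mem_domain_iff hE f).2 f.2⟩ = J (mulX μ f) := by
  have hdom : ∀ g : (mulX μ).domain, J g ∈ H.domain := fun g => (hJ.mem_domain_iff hE g).2 g.2
  let i : (mulX μ).domain →ₗ[ℂ] ℋ := J.toLinearMap ∘ₗ (mulX μ).domain.subtype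
  let A : (mulX μ).domain →ₗ[ℂ] ℋ :=
    H.toFun ∘ₗ i.codRestrict H.domain hdom - J.toLinearMap ∘ₗ (mulX μ).toFun
  have hA : ∀ g, A g = H ⟨J g, hdom g⟩ - J (mulX μ g) := fun g => rfl
  -- The quadratic forms of `H` and of multiplication by `x` agree, so by polarization the defect
  -- `A` is invisible to vectors `J g`.
  have hpol : ∀ g h : (mulX μ).domain, ⟪J g, A h⟫_ℂ = 0 := by
    refine inner_eq_zero_of_forall_inner_self i A fun g => ?_
    change ⟪J g, A g⟫_ℂ = 0
    rw [hA, inner_sub_right, hE.2 ⟨J g, hdom g⟩, J.inner_map_map, inner_mulX_self,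
      hJ.integral_vecMeasure]
    simp
  have hker : ∀ (χ : ℋ) (g : Lp ℂ 2 μ),
      ⟪χ - J (J.toContinuousLinearMap.adjoint χ), J g⟫_ℂ = 0 := by
    intro χ g
    rw [inner_sub_left, J.inner_map_map, ContinuousLinearMap.adjoint_inner_left]
    simp
  -- Split `χ` into `J J* χ`, handled by `hpol`, and a remainder in the domain orthogonal to the
  -- range of `J`. That range is invariant under `E`, so the form of `H` between the remainder and
  -- `J f` vanishes.
  have hzero : ∀ χ ∈ H.domain, ⟪χ, A f⟫_ℂ = 0 := by
    intro χ hχ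
    have h1 : J (J.toContinuousLinearMap.adjoint χ) ∈ H.domain :=
      hJ.proj_range_mem_domain hE hχ
    have h2 := hpol ⟨J.toContinuousLinearMap.adjoint χ, (hJ.mem_domain_iff hE _).1 h1⟩ f
    have h3 := hE.inner_apply_eq_zero
      ⟨χ - J (J.toContinuousLinearMap.adjoint χ), H.domain.sub_mem hχ h1⟩ ⟨J f, hdom f⟩
      (fun B hB => by rw [hJ B hB]; exact hker χ _)
    have h4 : ⟪χ - J (J.toContinuousLinearMap.adjoint χ), A f⟫_ℂ = 0 := by
      rw [hA, inner_sub_right, hker, h3, sub_zero]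
    rw [inner_sub_left] at h4
    exact (sub_eq_zero.1 h4).trans h2
  have : A f = 0 := hd.eq_zero_of_inner_right ℂ hzero
  rw [hA, sub_eq_zero] at this
  exact this

/-- The spectral representation of an operator with a cyclic vector. -/
theorem exists_spectral_representation (hE : IsSpectralMeasure H E)
    (hd : Dense (H.domain : Set ℋ)) {φ : ℋ} (hφ : IsCyclicVector H φ) :
    ∃ V : ℋ ≃ₗᵢ[ℂ] Lp ℂ 2 (E.vecMeasure φ),
      (V φ =ᵐ[E.vecMeasure φ] fun _ => (1 : ℂ)) ∧
      pullback V (mulX (E.vecMeasure φ)) = H ∧ Intertwines E V.symm.toLinearIsometry := by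
  have hfin := E.isFiniteMeasure_vecMeasure φ
  have hex := E.exists_isometry φ
  generalize E.vecMeasure φ = μ at hfin hex ⊢
  obtain ⟨J, hJ1, hJ⟩ := hex
  have h1 : MemLp (fun _ : ℝ => (1 : ℂ)) 2 μ := memLp_const 1
  have hφ1 : J (h1.toLp _) = φ := hJ1 _ h1.coeFn_toLp
  -- The range contains `φ = J 1`, and `H J f = J (x f)` propagates this to all `Hⁿφ`; being closed,
  -- it is everything.
  have hsurj : Function.Surjective J := by
    obtain ⟨-, x, hx0, hx, hdense⟩ := hφ
    have hmem : ∀ n, (x n : ℋ) ∈ LinearMap.range J.toLinearMap := by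
      intro n
      induction n with
      | zero => exact ⟨_, hφ1.trans hx0.symm⟩
      | succ n ih =>
        obtain ⟨f, hf⟩ := ih
        change J f = x n at hf
        have hf' : f ∈ (mulX μ).domain := (hJ.mem_domain_iff hE f).1 (hf ▸ (x n).2)
        refine ⟨mulX μ ⟨f, hf'⟩, ?_⟩
        rw [hx n]
        change J _ = _
        rw [← hJ.apply_eq hE hd ⟨f, hf'⟩]
        congr 1
        exact Subtype.ext hf
    have hcl : IsClosed (Set.range J) := J.isometry.isClosedEmbedding.isClosed_range
    have hsub : (Submodule.span ℂ (Set.range fun n => (x n : ℋ)) : Set ℋ) ⊆ Set.range J := by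
      have : Submodule.span ℂ (Set.range fun n => (x n : ℋ)) ≤ LinearMap.range J.toLinearMap :=
        Submodule.span_le.2 (by rintro _ ⟨n, rfl⟩; exact hmem n)
      exact this
    rw [← Set.range_eq_univ, ← Set.univ_subset_iff, ← hdense.closure_eq]
    exact closure_minimal hsub hcl
  set W := LinearIsometryEquiv.ofSurjective J hsurj with hW
  have hWJ : ∀ f, W f = J f := fun f => rfl
  refine ⟨W.symm, ?_, ?_, hJ⟩
  · have : W.symm φ = h1.toLp _ := by rw [LinearIsometryEquiv.symm_apply_eq, hWJ, hφ1]
    rw [this]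
    exact h1.coeFn_toLp
  · refine LinearPMap.ext ?_ ?_
    · ext ψ
      change W.symm ψ ∈ (mulX μ).domain ↔ _
      rw [← hJ.mem_domain_iff hE, ← hWJ, W.apply_symm_apply]
    · intro ψ h1 h2
      change J (mulX μ ⟨W.symm ψ, h1⟩) = _
      rw [← hJ.apply_eq hE hd]
      congr 1
      exact Subtype.ext (W.apply_symm_apply ψ)

end Representation

/-! ### Exponential sums and their totality in `L²` -/

section Exponentials

theorem norm_exp_I_mul (t x : ℝ) : ‖Complex.exp (Complex.I * t * x)‖ = 1 := by
  have : Complex.I * t * x = ((t * x : ℝ) : ℂ) * Complex.I := by push_cast; ring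
  rw [this, Complex.norm_exp_ofReal_mul_I]

theorem continuous_exp_I_mul (t : ℝ) :
    Continuous fun x : ℝ => Complex.exp (Complex.I * t * x) := by fun_prop

theorem memLp_exp_I_mul {μ : Measure ℝ} (t : ℝ) :
    MemLp (fun x : ℝ => Complex.exp (Complex.I * t * x)) ∞ μ :=
  memLp_top_of_bound (continuous_exp_I_mul t).aestronglyMeasurable 1
    (.of_forall fun x => (norm_exp_I_mul t x).le)

theorem hasDerivAt_exp_I_mul (t x : ℝ) :
    HasDerivAt (fun x : ℝ => Complex.exp (Complex.I * t * x))
      (Complex.I * t * Complex.exp (Complex.I * t * x)) x := by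
  have h1 : HasDerivAt (fun y : ℝ => (y : ℂ)) 1 x := Complex.ofRealCLM.hasDerivAt
  convert (h1.const_mul (Complex.I * t)).cexp using 1
  ring

theorem exp_mem_expSpan (t : ℝ) : (fun x : ℝ => Complex.exp (Complex.I * t * x)) ∈ expSpan :=
  Submodule.subset_span ⟨t, rfl⟩

theorem deriv_mem_expSpan {F : ℝ → ℂ} (hF : F ∈ expSpan) : deriv F ∈ expSpan := by
  unfold expSpan at hF
  induction hF using Submodule.span_induction with
  | mem F h =>
    obtain ⟨t, rfl⟩ := h
    have : deriv (fun x : ℝ => Complex.exp (Complex.I * t * x)) =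
        (Complex.I * t) • fun x : ℝ => Complex.exp (Complex.I * t * x) := by
      ext x
      rw [(hasDerivAt_exp_I_mul t x).deriv]
      rfl
    rw [this]
    exact Submodule.smul_mem _ _ (exp_mem_expSpan t)
  | zero =>
    have : deriv (0 : ℝ → ℂ) = 0 := by
      ext x
      exact deriv_const x 0
    rw [this]
    exact Submodule.zero_mem _
  | add F G hF hG h1 h2 =>
    have : deriv (F + G) = deriv F + deriv G := by
      ext x
      exact deriv_add (differentiable_of_mem_expSpan hF x) (differentiable_of_mem_expSpan hG x)
    rw [this]
    exact Submodule.add_mem _ h1 h2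
  | smul c F hF h =>
    have : deriv (c • F) = c • deriv F := by
      ext x
      exact deriv_const_smul c (differentiable_of_mem_expSpan hF x)
    rw [this]
    exact Submodule.smul_mem _ _ h

theorem exists_bound_of_mem_expSpan {F : ℝ → ℂ} (hF : F ∈ expSpan) : ∃ C, ∀ x, ‖F x‖ ≤ C := by
  unfold expSpan at hF
  induction hF using Submodule.span_induction with
  | mem F h =>
    obtain ⟨t, rfl⟩ := h
    exact ⟨1, fun x => (norm_exp_I_mul t x).le⟩
  | zero => exact ⟨0, fun x => by simp⟩
  | add F G _ _ h1 h2 =>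
    obtain ⟨C, hC⟩ := h1
    obtain ⟨D, hD⟩ := h2
    exact ⟨C + D, fun x => norm_add_le_of_le (hC x) (hD x)⟩
  | smul c F _ h =>
    obtain ⟨C, hC⟩ := h
    refine ⟨‖c‖ * C, fun x => ?_⟩
    rw [Pi.smul_apply, norm_smul]
    gcongr
    exact hC x

theorem exp_mul_mem_expSpan (t : ℝ) {F : ℝ → ℂ} (hF : F ∈ expSpan) :
    (fun x : ℝ => Complex.exp (Complex.I * t * x) * F x) ∈ expSpan := by
  unfold expSpan at hF
  induction hF using Submodule.span_induction with
  | mem F h =>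
    obtain ⟨s, rfl⟩ := h
    convert exp_mem_expSpan (t + s) using 2 with x
    rw [← Complex.exp_add]
    push_cast
    ring_nf
  | zero =>
    convert Submodule.zero_mem expSpan using 1
    ext x
    simp
  | add F G _ _ h1 h2 =>
    convert Submodule.add_mem _ h1 h2 using 1
    ext x
    simp [mul_add]
  | smul c F _ h =>
    convert Submodule.smul_mem _ c h using 1
    ext x
    simp [mul_left_comm]

theorem memLp_top_of_mem_expSpan {μ : Measure ℝ} {F : ℝ → ℂ} (hF : F ∈ expSpan) :
    MemLp F ∞ μ := by
  obtain ⟨C, hC⟩ := exists_bound_of_mem_expSpan hF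
  exact memLp_top_of_bound (differentiable_of_mem_expSpan hF).continuous.aestronglyMeasurable C
    (.of_forall hC)

/-- A real integrable function with vanishing Fourier transform vanishes almost everywhere. -/
theorem ae_eq_zero_of_integral_exp_mul_ofReal {μ : Measure ℝ} [IsFiniteMeasure μ] {u : ℝ → ℝ}
    (hu : Integrable u μ)
    (h : ∀ t : ℝ, ∫ x, Complex.exp (Complex.I * t * x) * (u x : ℂ) ∂μ = 0) : u =ᵐ[μ] 0 := by
  have hfin : ∀ v : ℝ → ℝ, Integrable v μ →
      IsFiniteMeasure (μ.withDensity fun x => ENNReal.ofReal (v x)) := fun v hv =>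
    isFiniteMeasure_withDensity_ofReal hv.2
  have hint : ∀ v : ℝ → ℝ, Integrable v μ → ∀ t : ℝ,
      Integrable (fun x : ℝ => Complex.exp (Complex.I * t * x) * (v x : ℂ)) μ := fun v hv t =>
    hv.ofReal.bdd_mul (c := 1) (continuous_exp_I_mul t).aestronglyMeasurable
      (.of_forall fun x => (norm_exp_I_mul t x).le)
  have hchar : ∀ v : ℝ → ℝ, Integrable v μ → ∀ t : ℝ,
      charFun (μ.withDensity fun x => ENNReal.ofReal (v x)) t =
        ∫ x, Complex.exp (Complex.I * t * x) * ((max (v x) 0 : ℝ) : ℂ) ∂μ := by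
    intro v hv t
    rw [charFun_apply_real, integral_withDensity_eq_integral_toReal_smul₀
      hv.1.aemeasurable.ennreal_ofReal (.of_forall fun x => ENNReal.ofReal_lt_top)]
    refine integral_congr_ae (.of_forall fun x => ?_)
    simp only [ENNReal.toReal_ofReal', Complex.real_smul]
    rw [mul_comm]
    ring_nf
  have := hfin u hu
  have := hfin _ hu.neg
  -- The positive and negative parts of `u` define finite measures with the same characteristic
  -- function.
  have heq : (μ.withDensity fun x => ENNReal.ofReal (u x)) =
      μ.withDensity fun x => ENNReal.ofReal ((-u) x) := by
    refine Measure.ext_of_charFun (funext fun t => ?_)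
    rw [hchar u hu, hchar _ hu.neg, ← sub_eq_zero,
      ← integral_sub (hint _ hu.pos_part t) (hint _ hu.neg.pos_part t), ← h t]
    refine integral_congr_ae (.of_forall fun x => ?_)
    dsimp only
    rw [← mul_sub, ← Complex.ofReal_sub, Pi.neg_apply]
    congr 2
    rcases le_total 0 (u x) with h | h <;> simp [h]
  have hae := (withDensity_eq_iff hu.1.aemeasurable.ennreal_ofReal
    hu.neg.1.aemeasurable.ennreal_ofReal hu.lintegral_lt_top.ne).1 heq
  filter_upwards [hae] with x hx
  rcases le_total 0 (u x) with h | h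
  · rw [ENNReal.ofReal_of_nonpos (p := (-u) x) (by simpa using h), ENNReal.ofReal_eq_zero] at hx
    exact le_antisymm hx h
  · rw [ENNReal.ofReal_of_nonpos h, eq_comm, ENNReal.ofReal_eq_zero] at hx
    exact le_antisymm h (by simpa using hx)

/-- Conjugating the hypothesis at `-t` gives it for the conjugate of `g`, hence for the real and
imaginary parts, where the real case applies. -/
theorem ae_eq_zero_of_integral_exp_mul {μ : Measure ℝ} [IsFiniteMeasure μ] {g : ℝ → ℂ}
    (hg : Integrable g μ)
    (h : ∀ t : ℝ, ∫ x, Complex.exp (Complex.I * t * x) * g x ∂μ = 0) : g =ᵐ[μ] 0 := by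
  have hint : ∀ v : ℝ → ℂ, Integrable v μ → ∀ t : ℝ,
      Integrable (fun x : ℝ => Complex.exp (Complex.I * t * x) * v x) μ := fun v hv t =>
    hv.bdd_mul (c := 1) (continuous_exp_I_mul t).aestronglyMeasurable
      (.of_forall fun x => (norm_exp_I_mul t x).le)
  have hgc : Integrable (fun x => (starRingEnd ℂ) (g x)) μ :=
    Complex.conjLIE.toContinuousLinearEquiv.toContinuousLinearMap.integrable_comp hg
  have hc : ∀ t : ℝ, ∫ x, Complex.exp (Complex.I * t * x) * (starRingEnd ℂ) (g x) ∂μ = 0 := by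
    intro t
    have h1 := congrArg (starRingEnd ℂ) (h (-t))
    rw [← integral_conj, map_zero] at h1
    rw [← h1]
    refine integral_congr_ae (.of_forall fun x => ?_)
    simp [← Complex.exp_conj]
  have hre := ae_eq_zero_of_integral_exp_mul_ofReal (μ := μ) (u := fun x => (g x).re) hg.re
    (fun t => by
      have : ∫ x, (Complex.exp (Complex.I * t * x) * g x +
          Complex.exp (Complex.I * t * x) * (starRingEnd ℂ) (g x)) / 2 ∂μ = 0 := by
        rw [integral_div, integral_add (hint _ hg t) (hint _ hgc t), h, hc]
        simp
      rw [← this]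
      refine integral_congr_ae (.of_forall fun x => ?_)
      dsimp only
      rw [Complex.re_eq_add_conj]
      ring)
  have him := ae_eq_zero_of_integral_exp_mul_ofReal (μ := μ) (u := fun x => (g x).im) hg.im
    (fun t => by
      have : ∫ x, (Complex.exp (Complex.I * t * x) * g x -
          Complex.exp (Complex.I * t * x) * (starRingEnd ℂ) (g x)) / (2 * Complex.I) ∂μ = 0 := by
        rw [integral_div, integral_sub (hint _ hg t) (hint _ hgc t), h, hc]
        simp
      rw [← this]
      refine integral_congr_ae (.of_forall fun x => ?_)
      dsimp only
      rw [Complex.im_eq_sub_conj]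
      ring)
  filter_upwards [hre, him] with x h1 h2
  exact Complex.ext h1 h2

/-- The exponentials are total in `L²` of a finite measure. -/
theorem dense_of_exp_mem {μ : Measure ℝ} [IsFiniteMeasure μ] (S : Submodule ℂ (Lp ℂ 2 μ))
    (hS : ∀ t : ℝ, ∃ f ∈ S, (f : ℝ → ℂ) =ᵐ[μ] fun x => Complex.exp (Complex.I * t * x)) :
    Dense (S : Set (Lp ℂ 2 μ)) := by
  rw [Submodule.dense_iff_topologicalClosure_eq_top, Submodule.topologicalClosure_eq_top_iff,
    Submodule.eq_bot_iff]
  intro g hg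
  have hgi : Integrable (g : ℝ → ℂ) μ := (Lp.memLp g).integrable (by norm_num)
  have hgc : Integrable (fun x => (starRingEnd ℂ) (g x)) μ :=
    Complex.conjLIE.toContinuousLinearEquiv.toContinuousLinearMap.integrable_comp hgi
  have h0 := ae_eq_zero_of_integral_exp_mul hgc fun t => by
    obtain ⟨f, hf, hfe⟩ := hS t
    have h1 : ⟪g, f⟫_ℂ = 0 := (Submodule.mem_orthogonal' S g).1 hg f hf
    rw [L2.inner_def] at h1
    rw [← h1]
    refine integral_congr_ae ?_
    filter_upwards [hfe] with x hx
    rw [hx]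
    rfl
  rw [Lp.eq_zero_iff_ae_eq_zero]
  filter_upwards [h0] with x hx
  simpa using hx

end Exponentials

/-! ### The operator `Y` in `L²(ρ dλ)` -/

/-- A differentiable integrable density on `ℝ` vanishing at `±∞`, with finite Fisher
information. -/
structure IsFisherDensity (ρ : ℝ → ℝ) : Prop where
  nonneg : ∀ x, 0 ≤ ρ x
  differentiable : Differentiable ℝ ρ
  integrable : Integrable ρ
  tendsto_atTop : Tendsto ρ atTop (𝓝 0)
  tendsto_atBot : Tendsto ρ atBot (𝓝 0)
  fisher : IntegrableOn (fun x => deriv ρ x ^ 2 / ρ x) {x | 0 < ρ x} volume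

/-- The measure with density `ρ` with respect to Lebesgue measure. -/
noncomputable abbrev densityMeasure (ρ : ℝ → ℝ) : Measure ℝ :=
  volume.withDensity fun x => ENNReal.ofReal (ρ x)

/-- The function `i F' + (i/2) W F`. -/
noncomputable def timeFun (ρ : ℝ → ℝ) (F : ℝ → ℂ) (x : ℝ) : ℂ :=
  Complex.I * deriv F x + Complex.I / 2 * (logSlope ρ x : ℂ) * F x

theorem measurable_logSlope {ρ : ℝ → ℝ} (hρ : Differentiable ℝ ρ) : Measurable (logSlope ρ) :=
  Measurable.ite (measurableSet_lt measurable_const hρ.continuous.measurable)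
    ((measurable_deriv ρ).div hρ.continuous.measurable) measurable_const

namespace IsFisherDensity

variable {ρ : ℝ → ℝ}

theorem isFiniteMeasure (hρ : IsFisherDensity ρ) : IsFiniteMeasure (densityMeasure ρ) :=
  isFiniteMeasure_withDensity_ofReal hρ.integrable.2

/-- A zero of `ρ ≥ 0` is a minimum, so `ρ'` vanishes there. The default value of `W` is thus
harmless, and the integration by parts has no exceptional points. -/
theorem logSlope_mul (hρ : IsFisherDensity ρ) (x : ℝ) : logSlope ρ x * ρ x = deriv ρ x := by
  unfold logSlope
  split_ifs with h
  · exact div_mul_cancel₀ _ h.ne'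
  · have h0 : ρ x = 0 := le_antisymm (not_lt.1 h) (hρ.nonneg x)
    have : IsLocalMin ρ x := .of_forall fun y => by rw [h0]; exact hρ.nonneg y
    rw [zero_mul, this.deriv_eq_zero]

theorem integrable_iff (hρ : IsFisherDensity ρ)
    {F : Type*} [NormedAddCommGroup F] [NormedSpace ℝ F] (g : ℝ → F) :
    Integrable g (densityMeasure ρ) ↔ Integrable fun x => ρ x • g x := by
  rw [densityMeasure, integrable_withDensity_iff_integrable_smul'
    hρ.differentiable.continuous.measurable.ennreal_ofReal
    (.of_forall fun x => ENNReal.ofReal_lt_top)]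
  simp only [ENNReal.toReal_ofReal (hρ.nonneg _)]

theorem integral_eq (hρ : IsFisherDensity ρ)
    {F : Type*} [NormedAddCommGroup F] [NormedSpace ℝ F] (g : ℝ → F) :
    ∫ x, g x ∂(densityMeasure ρ) = ∫ x, ρ x • g x := by
  rw [densityMeasure, integral_withDensity_eq_integral_toReal_smul
    hρ.differentiable.continuous.measurable.ennreal_ofReal
    (.of_forall fun x => ENNReal.ofReal_lt_top)]
  simp only [ENNReal.toReal_ofReal (hρ.nonneg _)]

/-- The squared `L²(μ)`-norm of `W` is the Fisher information. -/
theorem memLp_logSlope (hρ : IsFisherDensity ρ) :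
    MemLp (fun x => (logSlope ρ x : ℂ)) 2 (densityMeasure ρ) := by
  refine MemLp.ofReal (f := logSlope ρ) ?_
  rw [memLp_two_iff_integrable_sq (measurable_logSlope hρ.differentiable).aestronglyMeasurable,
    hρ.integrable_iff]
  have hms : MeasurableSet {x | 0 < ρ x} :=
    measurableSet_lt measurable_const hρ.differentiable.continuous.measurable
  refine ((integrable_indicator_iff hms).2 hρ.fisher).congr (.of_forall fun x => ?_)
  by_cases h : 0 < ρ x
  · simp only [Set.indicator_of_mem (show x ∈ {x | 0 < ρ x} from h), logSlope, h, if_true,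
      smul_eq_mul]
    field_simp
  · simp [logSlope, h]

theorem memLp_expSpan (hρ : IsFisherDensity ρ)
    {F : ℝ → ℂ} (hF : F ∈ expSpan) : MemLp F 2 (densityMeasure ρ) :=
  have := hρ.isFiniteMeasure
  (memLp_top_of_mem_expSpan hF).mono_exponent le_top

theorem memLp_timeFun (hρ : IsFisherDensity ρ) {F : ℝ → ℂ} (hF : F ∈ expSpan) :
    MemLp (timeFun ρ F) 2 (densityMeasure ρ) := by
  refine ((hρ.memLp_expSpan (deriv_mem_expSpan hF)).const_mul Complex.I).add ?_
  exact (memLp_top_of_mem_expSpan hF).mul' (hρ.memLp_logSlope.const_mul (Complex.I / 2))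

theorem toLp_mem_timeGraph (hρ : IsFisherDensity ρ) {F : ℝ → ℂ} (hF : F ∈ expSpan) :
    ((hρ.memLp_expSpan hF).toLp F, (hρ.memLp_timeFun hF).toLp _) ∈
      timeGraph (densityMeasure ρ) ρ :=
  ⟨F, hF, (hρ.memLp_expSpan hF).coeFn_toLp, (hρ.memLp_timeFun hF).coeFn_toLp⟩

/-- `Y` is well defined: `i F' + (i/2) W F` depends only on the class of `F`. -/
theorem snd_eq_zero_of_mem_timeGraph (hρ : IsFisherDensity ρ)
    (p : Lp ℂ 2 (densityMeasure ρ) × Lp ℂ 2 (densityMeasure ρ))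
    (hp : p ∈ timeGraph (densityMeasure ρ) ρ) (h0 : p.1 = 0) : p.2 = 0 := by
  obtain ⟨F, hF, h1, h2⟩ := hp
  have hop : IsOpen {x | 0 < ρ x} :=
    isOpen_lt continuous_const hρ.differentiable.continuous
  have hm : AEMeasurable (fun x => ENNReal.ofReal (ρ x)) volume :=
    hρ.differentiable.continuous.measurable.ennreal_ofReal.aemeasurable
  have hF0 : F =ᵐ[densityMeasure ρ] 0 := by
    have := (Lp.eq_zero_iff_ae_eq_zero (f := p.1)).1 h0
    exact h1.symm.trans this
  have hF1 : ∀ᵐ x ∂(volume.restrict {x | 0 < ρ x}), F x = 0 := by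
    have := (ae_withDensity_iff' hm).1 hF0
    rw [ae_restrict_iff' hop.measurableSet]
    filter_upwards [this] with x hx hpos
    exact hx (by simpa using hpos)
  -- Continuity upgrades almost everywhere to everywhere on the open set `{ρ > 0}`, so `F'` vanishes
  -- there too; the complement is `μ`-null.
  have hF2 : Set.EqOn F 0 {x | 0 < ρ x} :=
    Measure.eqOn_open_of_ae_eq hF1 hop (differentiable_of_mem_expSpan hF).continuous.continuousOn
      continuousOn_const
  rw [Lp.eq_zero_iff_ae_eq_zero]
  refine h2.trans ?_
  refine (ae_withDensity_iff' hm).2 (.of_forall fun x hx => ?_)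
  have hpos : 0 < ρ x := by simpa using hx
  have hd : deriv F x = 0 := by
    have : F =ᶠ[𝓝 x] fun _ => 0 := hF2.eventuallyEq_of_mem (hop.mem_nhds hpos)
    rw [this.deriv_eq, deriv_const]
  dsimp only
  rw [hd, hF2 hpos]
  simp

/-- `Submodule.toLinearPMap` is faithful only on submodules that are graphs of functions;
well-definedness of `Y` is what ensures this. -/
theorem timeOp_graph (hρ : IsFisherDensity ρ) :
    (timeOp (densityMeasure ρ) ρ).graph = timeGraph (densityMeasure ρ) ρ :=
  Submodule.toLinearPMap_graph_eq _ hρ.snd_eq_zero_of_mem_timeGraph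

theorem exp_mem_timeOp_domain (hρ : IsFisherDensity ρ)
    (t : ℝ) : ∃ f ∈ (timeOp (densityMeasure ρ) ρ).domain,
    (f : ℝ → ℂ) =ᵐ[densityMeasure ρ] fun x => Complex.exp (Complex.I * t * x) :=
  ⟨_, Submodule.mem_map_of_mem (f := LinearMap.fst ℂ _ _)
    (hρ.toLp_mem_timeGraph (exp_mem_expSpan t)),
    (hρ.memLp_expSpan (exp_mem_expSpan t)).coeFn_toLp⟩

theorem mem_timeGraph (hρ : IsFisherDensity ρ) (f : (timeOp (densityMeasure ρ) ρ).domain) :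
    ((f : Lp ℂ 2 (densityMeasure ρ)), timeOp (densityMeasure ρ) ρ f) ∈
      timeGraph (densityMeasure ρ) ρ :=
  Submodule.mem_graph_toLinearPMap hρ.snd_eq_zero_of_mem_timeGraph f

/-- The integrand is the derivative of `ρ F̄ G`, by `ρ' = W ρ`. It is integrable because `F`, `G`
and their derivatives are bounded and `W` is in `L²` of a finite measure; `ρ → 0` removes the
boundary terms. -/
theorem integral_deriv_mul_eq_zero (hρ : IsFisherDensity ρ)
    {F G : ℝ → ℂ} (hF : F ∈ expSpan) (hG : G ∈ expSpan) :
    ∫ x, ((ρ x : ℂ) * ((starRingEnd ℂ) (deriv F x) * G x + (starRingEnd ℂ) (F x) * deriv G x +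
      logSlope ρ x * ((starRingEnd ℂ) (F x) * G x))) = 0 := by
  have := hρ.isFiniteMeasure
  have hFd := differentiable_of_mem_expSpan hF
  have hGd := differentiable_of_mem_expSpan hG
  have hconj : ∀ {F : ℝ → ℂ}, MemLp F ∞ (densityMeasure ρ) →
      MemLp (fun x => (starRingEnd ℂ) (F x)) ∞ (densityMeasure ρ) := fun h =>
    Complex.conjLIE.toContinuousLinearEquiv.toContinuousLinearMap.comp_memLp' h
  have hF1 := hconj (memLp_top_of_mem_expSpan hF)
  have hF2 := hconj (memLp_top_of_mem_expSpan (deriv_mem_expSpan hF))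
  have hG1 := memLp_top_of_mem_expSpan (μ := densityMeasure ρ) hG
  have hG2 := memLp_top_of_mem_expSpan (μ := densityMeasure ρ) (deriv_mem_expSpan hG)
  have hlim : ∀ l : Filter ℝ, Tendsto ρ l (𝓝 0) →
      Tendsto (fun x => (ρ x : ℂ) * ((starRingEnd ℂ) (F x) * G x)) l (𝓝 0) := by
    intro l hl
    obtain ⟨C, hC⟩ := exists_bound_of_mem_expSpan hF
    obtain ⟨D, hD⟩ := exists_bound_of_mem_expSpan hG
    have hC0 : 0 ≤ C := (norm_nonneg _).trans (hC 0)
    refine squeeze_zero_norm (a := fun x => ρ x * (C * D)) (fun x => ?_)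
      (by simpa using hl.mul_const (C * D))
    rw [norm_mul, norm_mul, Complex.norm_real, Real.norm_of_nonneg (hρ.nonneg x), RCLike.norm_conj]
    have := hρ.nonneg x
    gcongr
    · exact hC x
    · exact hD x
  have key := integral_of_hasDerivAt_of_tendsto
    (f := fun x => (ρ x : ℂ) * ((starRingEnd ℂ) (F x) * G x))
    (f' := fun x => (ρ x : ℂ) * ((starRingEnd ℂ) (deriv F x) * G x +
      (starRingEnd ℂ) (F x) * deriv G x + logSlope ρ x * ((starRingEnd ℂ) (F x) * G x)))
    (fun x => by
      have h1 : HasDerivAt (fun x => (ρ x : ℂ)) ((deriv ρ x : ℝ) : ℂ) x :=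
        (hρ.differentiable x).hasDerivAt.ofReal_comp
      have h2 : HasDerivAt (fun x => (starRingEnd ℂ) (F x)) ((starRingEnd ℂ) (deriv F x)) x :=
        (hFd x).hasDerivAt.star
      refine (h1.mul (h2.mul (hGd x).hasDerivAt)).congr_deriv ?_
      rw [← hρ.logSlope_mul x]
      simp only [Pi.mul_apply, Complex.ofReal_mul]
      ring)
    (by
      have hi : Integrable (fun x => (starRingEnd ℂ) (deriv F x) * G x +
          (starRingEnd ℂ) (F x) * deriv G x + logSlope ρ x * ((starRingEnd ℂ) (F x) * G x))
          (densityMeasure ρ) := by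
        refine (memLp_one_iff_integrable.1 ?_)
        have h1 : MemLp (fun x => (starRingEnd ℂ) (deriv F x) * G x) 1 (densityMeasure ρ) :=
          (hG1.mul' (r := ∞) hF2).mono_exponent le_top
        have h2 : MemLp (fun x => (starRingEnd ℂ) (F x) * deriv G x) 1 (densityMeasure ρ) :=
          (hG2.mul' (r := ∞) hF1).mono_exponent le_top
        have h3 : MemLp (fun x => (logSlope ρ x : ℂ) * ((starRingEnd ℂ) (F x) * G x)) 1
            (densityMeasure ρ) :=
          ((hG1.mul' (r := ∞) hF1).mul' (r := 2) hρ.memLp_logSlope).mono_exponent (by norm_num)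
        exact (h1.add h2).add h3
      rw [hρ.integrable_iff] at hi
      simpa only [Complex.real_smul] using hi)
    (hlim _ hρ.tendsto_atBot) (hlim _ hρ.tendsto_atTop)
  simpa using key

/-- The two contributions of `(i/2) W` add up to `i W`, so `⟪F, Y G⟫ - ⟪Y F, G⟫` is `i` times the
vanishing integral of `(ρ F̄ G)'`. -/
theorem timeGraph_symmetric (hρ : IsFisherDensity ρ)
    {p q : Lp ℂ 2 (densityMeasure ρ) × Lp ℂ 2 (densityMeasure ρ)}
    (hp : p ∈ timeGraph (densityMeasure ρ) ρ) (hq : q ∈ timeGraph (densityMeasure ρ) ρ) :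
    ⟪p.2, q.1⟫_ℂ = ⟪p.1, q.2⟫_ℂ := by
  obtain ⟨F, hF, hp1, hp2⟩ := hp
  obtain ⟨G, hG, hq1, hq2⟩ := hq
  rw [eq_comm, ← sub_eq_zero, L2.inner_def, L2.inner_def,
    ← integral_sub (L2.integrable_inner _ _) (L2.integrable_inner _ _)]
  have h1 : ∫ x, (⟪p.1 x, q.2 x⟫_ℂ - ⟪p.2 x, q.1 x⟫_ℂ) ∂(densityMeasure ρ) =
      ∫ x, Complex.I * ((starRingEnd ℂ) (deriv F x) * G x + (starRingEnd ℂ) (F x) * deriv G x +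
      logSlope ρ x * ((starRingEnd ℂ) (F x) * G x)) ∂(densityMeasure ρ) := by
    refine integral_congr_ae ?_
    filter_upwards [hp1, hp2, hq1, hq2] with x h1 h2 h3 h4
    rw [h1, h2, h3, h4]
    simp only [RCLike.inner_apply, map_add, map_mul, map_div₀, Complex.conj_I, Complex.conj_ofReal,
      map_ofNat]
    ring
  rw [h1, integral_const_mul, hρ.integral_eq]
  simp only [Complex.real_smul]
  rw [hρ.integral_deriv_mul_eq_zero hF hG, mul_zero]

theorem isSymmetricOp_timeOp (hρ : IsFisherDensity ρ) :
    IsSymmetricOp (timeOp (densityMeasure ρ) ρ) := by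
  have := hρ.isFiniteMeasure
  refine ⟨dense_of_exp_mem _ hρ.exp_mem_timeOp_domain, fun f g => ?_⟩
  exact hρ.timeGraph_symmetric (hρ.mem_timeGraph f) (hρ.mem_timeGraph g)

/-- The weak Weyl relation between `Y` and multiplication by `e^{-itx}`. -/
theorem timeOp_mulOp_exp (hρ : IsFisherDensity ρ) (t : ℝ) (f : (timeOp (densityMeasure ρ) ρ).domain)
    {m : ℝ → ℂ} (hm : MemLp m ∞ (densityMeasure ρ))
    (hmt : ∀ x, m x = Complex.exp (-(Complex.I * t * x))) :
    ∃ h : mulOp m hm f ∈ (timeOp (densityMeasure ρ) ρ).domain,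
      timeOp (densityMeasure ρ) ρ ⟨mulOp m hm f, h⟩ =
        mulOp m hm (timeOp (densityMeasure ρ) ρ f + (t : ℂ) • (f : Lp ℂ 2 (densityMeasure ρ))) := by
  obtain ⟨F, hF, h1, h2⟩ := hρ.mem_timeGraph f
  have hme : m = fun x : ℝ => Complex.exp (Complex.I * (-t : ℝ) * x) := by
    ext x
    rw [hmt]
    push_cast
    ring_nf
  have hg : (mulOp m hm f,
      mulOp m hm (timeOp (densityMeasure ρ) ρ f + (t : ℂ) • (f : Lp ℂ 2 (densityMeasure ρ)))) ∈
      timeGraph (densityMeasure ρ) ρ := by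
    refine ⟨_, exp_mul_mem_expSpan (-t) hF, ?_, ?_⟩
    · filter_upwards [coeFn_mulOp m hm f, h1] with x h3 h4
      rw [h3, hme, ← h4]
    · filter_upwards [coeFn_mulOp m hm (timeOp (densityMeasure ρ) ρ f +
          (t : ℂ) • (f : Lp ℂ 2 (densityMeasure ρ))), h1, h2,
        Lp.coeFn_add (timeOp (densityMeasure ρ) ρ f)
          ((t : ℂ) • (f : Lp ℂ 2 (densityMeasure ρ))),
        Lp.coeFn_smul (t : ℂ) (f : Lp ℂ 2 (densityMeasure ρ))] with x h3 h4 h5 h6 h7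
      -- Differentiating the exponential factor produces the extra term `i · (-it) e^{-itx} F = t
      -- e^{-itx} F`.
      have hd := ((hasDerivAt_exp_I_mul (-t) x).mul
        (differentiable_of_mem_expSpan hF x).hasDerivAt).deriv
      have hd' : deriv (fun x : ℝ => Complex.exp (Complex.I * (-t : ℝ) * x) * F x) x = _ := hd
      rw [h3, h6, Pi.add_apply, h7, Pi.smul_apply, h4, h5, hd', hme]
      push_cast
      simp only [smul_eq_mul]
      linear_combination ((t : ℂ) * Complex.exp (Complex.I * -t * x) * F x) * Complex.I_sq
  rw [← hρ.timeOp_graph, LinearPMap.mem_graph_iff] at hg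
  obtain ⟨g, hg1, hg2⟩ := hg
  dsimp only at hg1 hg2
  refine ⟨hg1 ▸ g.2, ?_⟩
  rw [← hg2]
  congr 1
  exact Subtype.ext hg1.symm

end IsFisherDensity

/-! ### Resolvents of a self-adjoint operator at `±i` -/

section Resolvent

variable {ℋ : Type*} [NormedAddCommGroup ℋ] [InnerProductSpace ℂ ℋ] [CompleteSpace ℋ]
  {H : ℋ →ₗ.[ℂ] ℋ}

theorem inner_apply_of_isSelfAdjoint (hH : IsSelfAdjoint H) (x y : H.domain) :
    ⟪H x, (y : ℋ)⟫_ℂ = ⟪(x : ℋ), H y⟫_ℂ := by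
  have h := LinearPMap.adjoint_isFormalAdjoint hH.dense_domain
  rw [LinearPMap.isSelfAdjoint_def.1 hH] at h
  exact h x y

/-- `⟪Hx, x⟫` is real, so the cross term vanishes for `c = ±i`. It follows that `H + c` is bounded
below. -/
theorem norm_sq_apply_add_smul (hH : IsSelfAdjoint H) {c : ℂ}
    (hc : c = Complex.I ∨ c = -Complex.I) (x : H.domain) :
    ‖H x + c • (x : ℋ)‖ ^ 2 = ‖H x‖ ^ 2 + ‖(x : ℋ)‖ ^ 2 := by
  have him : (⟪H x, (x : ℋ)⟫_ℂ).im = 0 := by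
    rw [← Complex.conj_eq_iff_im, inner_conj_symm]
    exact (inner_apply_of_isSelfAdjoint hH x x).symm
  have hn : ‖c‖ = 1 := by rcases hc with rfl | rfl <;> simp
  have hre : (⟪H x, c • (x : ℋ)⟫_ℂ).re = 0 := by
    rw [inner_smul_right]
    rcases hc with rfl | rfl <;> simp [him]
  rw [@norm_add_sq ℂ, norm_smul, hn, one_mul]
  simp [hre]

/-- The resolvent of a self-adjoint operator at `±i`. -/
theorem exists_resolvent (hH : IsSelfAdjoint H) {c : ℂ} (hc : c = Complex.I ∨ c = -Complex.I) :
    ∃ R : ℋ →L[ℂ] ℋ, (∀ χ, ∃ h : R χ ∈ H.domain, H ⟨R χ, h⟩ + c • R χ = χ) ∧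
      ∀ ψ : H.domain, R (H ψ + c • (ψ : ℋ)) = ψ := by
  have hcl : IsClosed (H.graph : Set (ℋ × ℋ)) := hH.isClosed
  have : CompleteSpace H.graph := hcl.completeSpace_coe
  -- `H + c` viewed as a bounded operator on the graph of `H`, which is complete because `H` is
  -- closed.
  let L : H.graph →L[ℂ] ℋ :=
    (ContinuousLinearMap.snd ℂ ℋ ℋ + c • ContinuousLinearMap.fst ℂ ℋ ℋ) ∘L H.graph.subtypeL
  have hL : ∀ p, L p = (p : ℋ × ℋ).2 + c • (p : ℋ × ℋ).1 := fun p => rfl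
  have hanti : AntilipschitzWith 1 L := by
    refine AddMonoidHomClass.antilipschitz_of_bound L fun p => ?_
    obtain ⟨x, hx1, hx2⟩ := (LinearPMap.mem_graph_iff H).1 p.2
    have h := norm_sq_apply_add_smul hH hc x
    rw [hx1, hx2, ← hL] at h
    rw [NNReal.coe_one, one_mul, ← Submodule.norm_coe, Prod.norm_def]
    refine max_le ?_ ?_ <;> refine abs_le_of_sq_le_sq' ?_ (norm_nonneg _) |>.2 <;> rw [h]
    · exact le_add_of_nonneg_left (sq_nonneg _)
    · exact le_add_of_nonneg_right (sq_nonneg _)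
  have hker : L.ker = ⊥ := LinearMap.ker_eq_bot.2 hanti.injective
  have hrange : L.range = ⊤ := by
    have hrc : IsClosed (L.range : Set ℋ) := hanti.isClosed_range L.uniformContinuous
    have : CompleteSpace L.range := hrc.completeSpace_coe
    rw [← Submodule.orthogonal_eq_bot_iff, Submodule.eq_bot_iff]
    intro y hy
    -- A vector `y` orthogonal to the range lies in the domain of `H* = H` with `H y = c y`; the
    -- norm identity for `-c` then forces `y = 0`.
    have h1 : ∀ x : H.domain, ⟪c • y, (x : ℋ)⟫_ℂ = ⟪y, H x⟫_ℂ := by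
      intro x
      have h2 := (Submodule.mem_orthogonal' _ y).1 hy _
        ⟨⟨((x : ℋ), H x), H.mem_graph x⟩, rfl⟩
      change ⟪y, H x + c • (x : ℋ)⟫_ℂ = 0 at h2
      rw [inner_add_right, inner_smul_right] at h2
      rw [inner_smul_left]
      rcases hc with rfl | rfl
      · rw [Complex.conj_I]
        linear_combination -h2
      · rw [map_neg, Complex.conj_I]
        linear_combination -h2
    have h2 : y ∈ H.adjoint.domain := H.mem_adjoint_domain_of_exists y ⟨_, h1⟩
    have h3 : H.adjoint ⟨y, h2⟩ = c • y :=
      LinearPMap.adjoint_apply_eq hH.dense_domain ⟨y, h2⟩ h1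
    have h4 : ∃ h : y ∈ H.domain, H ⟨y, h⟩ = c • y := by
      rw [LinearPMap.isSelfAdjoint_def] at hH
      generalize H.adjoint = S at *
      subst hH
      exact ⟨h2, h3⟩
    obtain ⟨h5, h6⟩ := h4
    have hc' : -c = Complex.I ∨ -c = -Complex.I := by
      rcases hc with rfl | rfl <;> simp
    have h7 := norm_sq_apply_add_smul hH hc' ⟨y, h5⟩
    rw [h6, neg_smul, add_neg_cancel, norm_zero] at h7
    have h8 : ‖y‖ ^ 2 = 0 := by nlinarith [sq_nonneg ‖c • y‖, sq_nonneg ‖y‖]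
    simpa using h8
  let e := ContinuousLinearEquiv.ofBijective L hker hrange
  have he : ∀ p, e p = L p := fun p => rfl
  refine ⟨ContinuousLinearMap.fst ℂ ℋ ℋ ∘L H.graph.subtypeL ∘L e.symm.toContinuousLinearMap,
    fun χ => ?_, fun ψ => ?_⟩
  · obtain ⟨x, hx1, hx2⟩ := (LinearPMap.mem_graph_iff H).1 (e.symm χ).2
    have h1 : ((e.symm χ : H.graph) : ℋ × ℋ).1 ∈ H.domain := hx1 ▸ x.2
    refine ⟨h1, ?_⟩
    change H ⟨((e.symm χ : H.graph) : ℋ × ℋ).1, h1⟩ + c • ((e.symm χ : H.graph) : ℋ × ℋ).1 = χ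
    have h2 : H ⟨((e.symm χ : H.graph) : ℋ × ℋ).1, h1⟩ = ((e.symm χ : H.graph) : ℋ × ℋ).2 := by
      rw [← hx2]
      congr 1
      exact Subtype.ext hx1.symm
    rw [h2, ← hL, ← he, e.apply_symm_apply]
  · have h1 : H ψ + c • (ψ : ℋ) = e ⟨((ψ : ℋ), H ψ), H.mem_graph ψ⟩ := rfl
    rw [h1]
    change ((e.symm (e _) : H.graph) : ℋ × ℋ).1 = ψ
    rw [e.symm_apply_apply]

/-- The resolvents at `i` and `-i` are adjoint to each other and satisfy the resolvent
identities. -/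
theorem exists_normal_resolvent (hH : IsSelfAdjoint H) :
    ∃ R : ℋ →L[ℂ] ℋ, (∀ χ, ∃ h : R χ ∈ H.domain, H ⟨R χ, h⟩ + Complex.I • R χ = χ) ∧
      (∀ ψ : H.domain, R (H ψ + Complex.I • (ψ : ℋ)) = ψ) ∧
      IsStarNormal R ∧ star R - R = (2 * Complex.I) • (star R * R) := by
  obtain ⟨R, hR1, hR2⟩ := exists_resolvent hH (Or.inl rfl)
  obtain ⟨S, hS1, hS2⟩ := exists_resolvent hH (Or.inr rfl)
  have hadj : star R = S := by
    rw [ContinuousLinearMap.star_eq_adjoint, eq_comm, ContinuousLinearMap.eq_adjoint_iff]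
    intro a b
    obtain ⟨ha, ha'⟩ := hS1 a
    obtain ⟨hb, hb'⟩ := hR1 b
    have h1 := inner_apply_of_isSelfAdjoint hH ⟨S a, ha⟩ ⟨R b, hb⟩
    conv_lhs => rw [← hb']
    conv_rhs => rw [← ha']
    rw [inner_add_right, inner_add_left, inner_smul_right, inner_smul_left, ← h1]
    simp
  -- The resolvent identity is proved in both orders; comparing the two shows that `R` and `S = R*`
  -- commute.
  have h1 : S - R = (2 * Complex.I) • (R * S) := by
    ext a
    obtain ⟨ha, ha'⟩ := hS1 a
    have h2 := hR2 ⟨S a, ha⟩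
    have h3 : H ⟨S a, ha⟩ + Complex.I • S a = a + (2 * Complex.I) • S a := by
      refine Eq.trans ?_ (congrArg (· + (2 * Complex.I) • S a) ha')
      module
    rw [h3, map_add, map_smul] at h2
    change S a - R a = (2 * Complex.I) • R (S a)
    rw [sub_eq_iff_eq_add']
    exact h2.symm
  have h2 : S - R = (2 * Complex.I) • (S * R) := by
    ext a
    obtain ⟨ha, ha'⟩ := hR1 a
    have h2 := hS2 ⟨R a, ha⟩
    have h3 : H ⟨R a, ha⟩ + -Complex.I • R a = a - (2 * Complex.I) • R a := by
      refine Eq.trans ?_ (congrArg (· - (2 * Complex.I) • R a) ha')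
      module
    rw [h3, map_sub, map_smul] at h2
    change S a - R a = (2 * Complex.I) • S (R a)
    rw [sub_eq_iff_eq_add'] at h2 ⊢
    rw [h2]
    exact add_comm _ _
  refine ⟨R, hR1, hR2, ⟨?_⟩, by rw [hadj, h2]⟩
  rw [hadj]
  have h3 : (2 * Complex.I) • (S * R) = (2 * Complex.I) • (R * S) := h2.symm.trans h1
  exact (smul_right_injective _ (by simp : (2 * Complex.I) ≠ 0)) h3

end Resolvent

/-! ### Bounded normal operators: the spectral measure and isometry of a vector -/

section NormalOperator

variable {ℋ : Type*} [NormedAddCommGroup ℋ] [InnerProductSpace ℂ ℋ] [CompleteSpace ℋ]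

/-- A positive functional on the real continuous functions on a compact space is integration
against a finite measure. -/
theorem exists_measure_of_nonneg {X : Type*} [TopologicalSpace X] [CompactSpace X] [T2Space X]
    [MeasurableSpace X] [BorelSpace X] (Λ : C(X, ℝ) →ₗ[ℝ] ℝ)
    (hΛ : ∀ f : C(X, ℝ), 0 ≤ f → 0 ≤ Λ f) :
    ∃ ν : Measure X, IsFiniteMeasure ν ∧ ν.WeaklyRegular ∧ ∀ f : C(X, ℝ), Λ f = ∫ x, f x ∂ν := by
  let Λ' : CompactlySupportedContinuousMap X ℝ →ₚ[ℝ] ℝ := PositiveLinearMap.mk₀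
    { toFun := fun f => Λ f.toContinuousMap
      map_add' := fun f g => Λ.map_add _ _
      map_smul' := fun c f => Λ.map_smul c _ } (fun f hf => hΛ _ hf)
  refine ⟨RealRMK.rieszMeasure Λ', inferInstance, inferInstance, fun f => ?_⟩
  exact (RealRMK.integral_rieszMeasure Λ'
    (CompactlySupportedContinuousMap.continuousMapEquiv f)).symm

variable {R : ℋ →L[ℂ] ℋ} (hR : IsStarNormal R)

theorem inner_cfcHom_star_mul (φ : ℋ) (f g : C(spectrum ℂ R, ℂ)) :
    ⟪cfcHom hR f φ, cfcHom hR g φ⟫_ℂ = ⟪φ, cfcHom hR (star f * g) φ⟫_ℂ := by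
  rw [map_mul, map_star, ContinuousLinearMap.star_eq_adjoint, mul_apply_eq_comp,
    ContinuousLinearMap.adjoint_inner_right]

/-- A real continuous function as a complex one. -/
def ofRealMap {X : Type*} [TopologicalSpace X] : C(X, ℝ) →ₗ[ℝ] C(X, ℂ) where
  toFun f := ⟨fun x => (f x : ℂ), by fun_prop⟩
  map_add' f g := by ext x; simp
  map_smul' c f := by ext x; simp

/-- The spectral measure of a vector for a bounded normal operator. -/
theorem exists_measure_cfcHom (φ : ℋ) :
    ∃ ν : Measure (spectrum ℂ R), IsFiniteMeasure ν ∧ ν.WeaklyRegular ∧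
      ∀ f : C(spectrum ℂ R, ℂ), ⟪φ, cfcHom hR f φ⟫_ℂ = ∫ x, f x ∂ν := by
  let Λ : C(spectrum ℂ R, ℝ) →ₗ[ℝ] ℝ :=
    { toFun := fun f => (⟪φ, cfcHom hR (ofRealMap f) φ⟫_ℂ).re
      map_add' := fun f g => by
        simp
      map_smul' := fun c f => by
        have : ofRealMap (c • f) = (c : ℂ) • ofRealMap f := by
          ext x
          simp [ofRealMap]
        rw [this, map_smul, smul_apply, inner_smul_right, Complex.re_ofReal_mul]
        rfl }
  have hre : ∀ f : C(spectrum ℂ R, ℝ), ⟪φ, cfcHom hR (ofRealMap f) φ⟫_ℂ = (Λ f : ℂ) := by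
    intro f
    have hs : star (ofRealMap f) = ofRealMap f := by
      ext x
      simp [ofRealMap]
    refine (Complex.conj_eq_iff_re.1 ?_).symm
    rw [inner_conj_symm, ← ContinuousLinearMap.adjoint_inner_right,
      ← ContinuousLinearMap.star_eq_adjoint, ← map_star, hs]
  obtain ⟨ν, h1, h2, h3⟩ := exists_measure_of_nonneg Λ (fun f hf => by
    -- Positivity: with `g = √f` the value of the functional is `‖g(R) φ‖²`.
    let g : C(spectrum ℂ R, ℝ) := ⟨fun x => √(f x), by fun_prop⟩
    have hfg : ofRealMap f = star (ofRealMap g) * ofRealMap g := by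
      ext x
      have h : f x = √(f x) * √(f x) := (Real.mul_self_sqrt (hf x)).symm
      simp only [ofRealMap, g, LinearMap.coe_mk, AddHom.coe_mk, ContinuousMap.coe_mk,
        ContinuousMap.mul_apply, ContinuousMap.star_apply, RCLike.star_def, Complex.conj_ofReal]
      exact_mod_cast h
    change 0 ≤ (⟪φ, cfcHom hR (ofRealMap f) φ⟫_ℂ).re
    rw [hfg, ← inner_cfcHom_star_mul]
    exact inner_self_nonneg (𝕜 := ℂ))
  refine ⟨ν, h1, h2, fun f => ?_⟩
  let u : C(spectrum ℂ R, ℝ) := ⟨fun x => (f x).re, by fun_prop⟩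
  let v : C(spectrum ℂ R, ℝ) := ⟨fun x => (f x).im, by fun_prop⟩
  have hf : f = ofRealMap u + Complex.I • ofRealMap v := by
    ext x
    simp [ofRealMap, u, v, mul_comm Complex.I]
  have hi : Integrable f ν :=
    (ContinuousMap.continuous f).integrable_of_hasCompactSupport
      (HasCompactSupport.of_compactSpace f)
  rw [hf, map_add, map_smul, add_apply, smul_apply,
    inner_add_right, inner_smul_right, hre, hre, h3, h3, ← hf, ← integral_re_add_im hi]
  simp [u, v, mul_comm Complex.I]

/-- The isometry `f ↦ f(R) φ` on `L²` of the spectral measure of `φ`, for a normal operator. -/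
theorem exists_isometry_of_isStarNormal (φ : ℋ) :
    ∃ ν : Measure (spectrum ℂ R), IsFiniteMeasure ν ∧ ∃ J : Lp ℂ 2 ν →ₗᵢ[ℂ] ℋ,
      φ ∈ Set.range J ∧ ∀ (g : C(spectrum ℂ R, ℂ)) (hg : MemLp g ∞ ν) (f : Lp ℂ 2 ν),
        cfcHom hR g (J f) = J (mulOp g hg f) := by
  obtain ⟨ν, h1, h2, h3⟩ := exists_measure_cfcHom hR φ
  -- Weak regularity of `ν` makes the continuous functions dense in `L²(ν)`.
  have hdr := ContinuousMap.toLp_denseRange (p := 2) ℂ ν ℂ (by simp)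
  have hdense : Dense (Submodule.span ℂ
      (Set.range fun f : C(spectrum ℂ R, ℂ) => ContinuousMap.toLp 2 ν ℂ f) : Set (Lp ℂ 2 ν)) :=
    hdr.mono Submodule.subset_span
  obtain ⟨J, hJ⟩ := exists_linearIsometry_of_inner_eq
    (fun f : C(spectrum ℂ R, ℂ) => ContinuousMap.toLp 2 ν ℂ f) (fun f => cfcHom hR f φ) hdense
    (fun f g => by
      rw [inner_cfcHom_star_mul, h3, ContinuousMap.inner_toLp]
      refine integral_congr_ae (.of_forall fun x => ?_)
      simp [mul_comm])
  refine ⟨ν, h1, J, ⟨ContinuousMap.toLp 2 ν ℂ 1, by rw [hJ, map_one]; rfl⟩, fun g hg f => ?_⟩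
  have key : Set.EqOn ((cfcHom hR g).comp J.toContinuousLinearMap)
      (J.toContinuousLinearMap.comp (mulOp g hg))
      (Set.range fun f : C(spectrum ℂ R, ℂ) => ContinuousMap.toLp 2 ν ℂ f) := by
    rintro _ ⟨f, rfl⟩
    have h4 : mulOp g hg (ContinuousMap.toLp 2 ν ℂ f) = ContinuousMap.toLp 2 ν ℂ (g * f) := by
      apply Lp.ext
      filter_upwards [coeFn_mulOp g hg (ContinuousMap.toLp 2 ν ℂ f),
        ContinuousMap.coeFn_toLp (p := 2) (𝕜 := ℂ) ν f,
        ContinuousMap.coeFn_toLp (p := 2) (𝕜 := ℂ) ν (g * f)] with x h5 h6 h7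
      rw [h5, h6, h7]
      rfl
    simp only [ContinuousLinearMap.comp_apply, LinearIsometry.coe_toContinuousLinearMap]
    rw [h4, hJ, hJ, map_mul]
    rfl
  exact congrArg (fun A : Lp ℂ 2 ν →L[ℂ] ℋ => A f) (ContinuousLinearMap.ext_on hdense key)

end NormalOperator

/-! ### The projection-valued measure of a real multiplication operator -/

section MultiplicationPVM

variable {ℋ : Type*} [NormedAddCommGroup ℋ] [InnerProductSpace ℂ ℋ]

/-- An orthogonal series of components of `y` converges to `y` if Parseval's identity holds. -/
theorem hasSum_of_orthogonal {x : ℕ → ℋ} {y : ℋ} (hx : Pairwise fun m n => ⟪x m, x n⟫_ℂ = 0)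
    (hxy : ∀ n, ⟪x n, y⟫_ℂ = (‖x n‖ ^ 2 : ℝ)) (hs : HasSum (fun n => ‖x n‖ ^ 2) (‖y‖ ^ 2)) :
    HasSum x y := by
  have hnorm : ∀ s : Finset ℕ, ‖y - ∑ n ∈ s, x n‖ ^ 2 = ‖y‖ ^ 2 - ∑ n ∈ s, ‖x n‖ ^ 2 := by
    intro s
    have h1 : ⟪∑ n ∈ s, x n, y⟫_ℂ = ((∑ n ∈ s, ‖x n‖ ^ 2 : ℝ) : ℂ) := by
      rw [sum_inner, Complex.ofReal_sum]
      exact Finset.sum_congr rfl fun n _ => hxy n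
    have h2 : ⟪∑ n ∈ s, x n, ∑ n ∈ s, x n⟫_ℂ = ((∑ n ∈ s, ‖x n‖ ^ 2 : ℝ) : ℂ) := by
      rw [sum_inner, Complex.ofReal_sum]
      refine Finset.sum_congr rfl fun n hn => ?_
      rw [inner_sum, Finset.sum_eq_single_of_mem n hn fun m _ hm => hx hm.symm,
        inner_self_eq_norm_sq_to_K]
      norm_cast
    have h3 : ‖∑ n ∈ s, x n‖ ^ 2 = ∑ n ∈ s, ‖x n‖ ^ 2 := by
      rw [← inner_self_eq_norm_sq (𝕜 := ℂ), h2]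
      exact Complex.ofReal_re _
    rw [norm_sub_rev, @norm_sub_sq ℂ, h1, h3]
    simp only [RCLike.re_to_complex, Complex.ofReal_re]
    ring
  rw [HasSum, tendsto_iff_norm_sub_tendsto_zero]
  have h4 : Tendsto (fun s : Finset ℕ => √(‖y‖ ^ 2 - ∑ n ∈ s, ‖x n‖ ^ 2)) atTop (𝓝 0) := by
    have := (hs.const_sub (‖y‖ ^ 2)).sqrt
    simpa using this
  refine h4.congr fun s => ?_
  rw [← hnorm s, Real.sqrt_sq (norm_nonneg _), norm_sub_rev]

variable {α : Type*} [MeasurableSpace α] {ν : Measure α}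

theorem mulOp_indicator_mul {A B : Set α} (hA : MeasurableSet A) (hB : MeasurableSet B) :
    mulOp (μ := ν) _ (memLp_indicator_one (hA.inter hB)) =
      mulOp _ (memLp_indicator_one hA) * mulOp _ (memLp_indicator_one hB) := by
  ext1 f
  apply Lp.ext
  change _ =ᵐ[ν] mulOp _ (memLp_indicator_one hA) (mulOp _ (memLp_indicator_one hB) f)
  filter_upwards [coeFn_mulOp_indicator hA (mulOp _ (memLp_indicator_one hB) f),
    coeFn_mulOp_indicator hB f, coeFn_mulOp_indicator (hA.inter hB) f] with x h1 h2 h3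
  rw [h1, h3, ← Set.indicator_indicator]
  by_cases h : x ∈ A <;> simp [h, h2]

theorem inner_mulOp_indicator {B : Set α} (hB : MeasurableSet B) (f g : Lp ℂ 2 ν) :
    ⟪mulOp _ (memLp_indicator_one hB) f, g⟫_ℂ = ⟪f, mulOp _ (memLp_indicator_one hB) g⟫_ℂ := by
  simp only [L2.inner_def]
  refine integral_congr_ae ?_
  filter_upwards [coeFn_mulOp_indicator hB f, coeFn_mulOp_indicator hB g] with x h1 h2
  rw [h1, h2]
  by_cases h : x ∈ B <;> simp [h]

theorem isStarProjection_mulOp_indicator {B : Set α} (hB : MeasurableSet B) :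
    IsStarProjection (mulOp (μ := ν) _ (memLp_indicator_one hB)) where
  isIdempotentElem := by
    have := mulOp_indicator_mul (ν := ν) hB hB
    simp only [Set.inter_self] at this
    exact this.symm
  isSelfAdjoint := by
    rw [isSelfAdjoint_iff, ContinuousLinearMap.star_eq_adjoint, eq_comm,
      ContinuousLinearMap.eq_adjoint_iff]
    exact inner_mulOp_indicator hB

/-- The pieces `1_{B n} f` are orthogonal components of the sum, and Parseval's identity is
countable additivity of `∫ |f|² dν`. -/
theorem hasSum_mulOp_indicator {B : ℕ → Set α} (hB : ∀ n, MeasurableSet (B n))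
    (hd : Pairwise (Function.onFun Disjoint B)) (f : Lp ℂ 2 ν) :
    HasSum (fun n => mulOp _ (memLp_indicator_one (hB n)) f)
      (mulOp _ (memLp_indicator_one (MeasurableSet.iUnion hB)) f) := by
  have hmul : ∀ {A C : Set α} (hA : MeasurableSet A) (hC : MeasurableSet C),
      ⟪mulOp _ (memLp_indicator_one hA) f, mulOp _ (memLp_indicator_one hC) f⟫_ℂ =
        ⟪f, mulOp _ (memLp_indicator_one (hA.inter hC)) f⟫_ℂ := by
    intro A C hA hC
    rw [inner_mulOp_indicator hA, mulOp_indicator_mul hA hC]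
    rfl
  refine hasSum_of_orthogonal (fun m n hmn => ?_) (fun n => ?_) ?_
  · have h0 : B m ∩ B n = ∅ := (hd hmn).inter_eq
    dsimp only
    rw [hmul (hB m) (hB n), inner_mulOp]
    simp [h0]
  · have h0 : B n ∩ ⋃ i, B i = B n := Set.inter_eq_left.2 (Set.subset_iUnion B n)
    have h1 : B n ∩ B n = B n := Set.inter_self _
    have h2 : ⟪mulOp _ (memLp_indicator_one (hB n)) f, mulOp _ (memLp_indicator_one (hB n)) f⟫_ℂ =
        (‖mulOp _ (memLp_indicator_one (hB n)) f‖ ^ 2 : ℝ) := by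
      rw [inner_self_eq_norm_sq_to_K]
      norm_cast
    rw [← h2, hmul (hB n) (MeasurableSet.iUnion hB), hmul (hB n) (hB n)]
    simp only [h0, h1]
  · have hr : ∀ {A : Set α} (hA : MeasurableSet A),
        ‖mulOp _ (memLp_indicator_one hA) f‖ ^ 2 =
          (∫⁻ x in A, ‖f x‖ₑ ^ 2 ∂ν).toReal := by
      intro A hA
      rw [← enorm_sq_mulOp_indicator hA, ENNReal.toReal_pow, toReal_enorm]
    have hfin : ∀ {A : Set α} (hA : MeasurableSet A), ∫⁻ x in A, ‖f x‖ₑ ^ 2 ∂ν ≠ ∞ := by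
      intro A hA
      rw [← enorm_sq_mulOp_indicator hA]
      exact ENNReal.pow_ne_top enorm_ne_top
    simp only [hr (hB _), hr (MeasurableSet.iUnion hB)]
    rw [lintegral_iUnion hB hd, ENNReal.tsum_toReal_eq fun n => hfin (hB n)]
    refine ENNReal.hasSum_toReal ?_
    rw [← lintegral_iUnion hB hd]
    exact hfin (MeasurableSet.iUnion hB)

variable [CompleteSpace ℋ]

open Classical in
/-- The projection-valued measure `B ↦ 1_{h⁻¹(B)}` of multiplication by a real function `h`,
carried to `ℋ` by a unitary operator. -/
noncomputable def mulPVM (W : Lp ℂ 2 ν ≃ₗᵢ[ℂ] ℋ) {h : α → ℝ} (hh : Measurable h) : PVM ℋ where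
  -- The value `0` off the Borel sets is arbitrary.
  proj B := if hB : MeasurableSet B then
    W.toContinuousLinearEquiv.toContinuousLinearMap ∘L
      mulOp _ (memLp_indicator_one (hh hB)) ∘L W.symm.toContinuousLinearEquiv.toContinuousLinearMap
    else 0
  isProj B hB := by
    rw [dif_pos hB]
    have hP := isStarProjection_mulOp_indicator (ν := ν) (hh hB)
    refine ⟨?_, ?_⟩
    · ext ψ
      have := congrArg (fun A : Lp ℂ 2 ν →L[ℂ] Lp ℂ 2 ν => A (W.symm ψ)) hP.isIdempotentElem.eq
      change W (mulOp _ (memLp_indicator_one (hh hB)) (W.symm (W (mulOp _ _ (W.symm ψ))))) =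
        W (mulOp _ _ (W.symm ψ))
      rw [W.symm_apply_apply]
      exact congrArg W this
    · rw [isSelfAdjoint_iff, ContinuousLinearMap.star_eq_adjoint, eq_comm,
        ContinuousLinearMap.eq_adjoint_iff]
      intro ψ η
      change ⟪W (mulOp _ (memLp_indicator_one (hh hB)) (W.symm ψ)), η⟫_ℂ =
        ⟪ψ, W (mulOp _ (memLp_indicator_one (hh hB)) (W.symm η))⟫_ℂ
      rw [← W.symm.inner_map_map, ← W.symm.inner_map_map ψ, W.symm_apply_apply,
        W.symm_apply_apply, inner_mulOp_indicator (hh hB)]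
  empty := by
    rw [dif_pos MeasurableSet.empty]
    ext ψ
    change W (mulOp _ _ (W.symm ψ)) = 0
    rw [W.map_eq_zero_iff, Lp.eq_zero_iff_ae_eq_zero]
    filter_upwards [coeFn_mulOp_indicator (hh MeasurableSet.empty) (W.symm ψ)] with x hx
    rw [hx]
    simp
  univ := by
    rw [dif_pos MeasurableSet.univ]
    ext ψ
    change W (mulOp _ _ (W.symm ψ)) = ψ
    rw [← LinearIsometryEquiv.eq_symm_apply]
    apply Lp.ext
    filter_upwards [coeFn_mulOp_indicator (hh MeasurableSet.univ) (W.symm ψ)] with x hx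
    rw [hx]
    simp
  inter A B hA hB := by
    rw [dif_pos hA, dif_pos hB, dif_pos (hA.inter hB)]
    ext ψ
    have := congrArg (fun A : Lp ℂ 2 ν →L[ℂ] Lp ℂ 2 ν => A (W.symm ψ))
      (mulOp_indicator_mul (ν := ν) (hh hA) (hh hB))
    change W (mulOp _ _ (W.symm ψ)) = W (mulOp _ _ (W.symm (W (mulOp _ _ (W.symm ψ)))))
    rw [W.symm_apply_apply]
    exact congrArg W this
  hasSum B hB hd ψ := by
    rw [dif_pos (MeasurableSet.iUnion hB)]
    simp only [dif_pos (hB _)]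
    have h1 := hasSum_mulOp_indicator (ν := ν) (fun n => hh (hB n))
      (fun m n hmn => (hd hmn).preimage h) (W.symm ψ)
    have h2 := W.toContinuousLinearEquiv.toContinuousLinearMap.hasSum h1
    simp only [Set.preimage_iUnion]
    exact h2

theorem vecMeasure_mulPVM (W : Lp ℂ 2 ν ≃ₗᵢ[ℂ] ℋ) {h : α → ℝ} (hh : Measurable h)
    (f : Lp ℂ 2 ν) :
    (mulPVM W hh).vecMeasure (W f) = (ν.withDensity fun x => ‖f x‖ₑ ^ 2).map h := by
  ext B hB
  have h1 : (mulPVM W hh).proj B (W f) = W (mulOp _ (memLp_indicator_one (hh hB)) f) := by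
    have h2 : (mulPVM W hh).proj B = W.toContinuousLinearEquiv.toContinuousLinearMap ∘L
        mulOp _ (memLp_indicator_one (hh hB)) ∘L
          W.symm.toContinuousLinearEquiv.toContinuousLinearMap := dif_pos hB
    rw [h2]
    change W (mulOp _ _ (W.symm (W f))) = _
    rw [W.symm_apply_apply]
  rw [PVM.vecMeasure_apply _ hB, h1, LinearIsometryEquiv.enorm_map,
    enorm_sq_mulOp_indicator (hh hB), Measure.map_apply hh hB, withDensity_apply _ (hh hB)]

/-- If a unitary operator carries multiplication by a real function `h`, with maximal domain,
to `H`, then `B ↦ 1_{h⁻¹(B)}` becomes a spectral measure of `H`. -/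
theorem isSpectralMeasure_mulPVM (W : Lp ℂ 2 ν ≃ₗᵢ[ℂ] ℋ) {h : α → ℝ} (hh : Measurable h)
    {H : ℋ →ₗ.[ℂ] ℋ} (hdom : ∀ f : Lp ℂ 2 ν, W f ∈ H.domain ↔ MemLp (fun x => (h x : ℂ) * f x) 2 ν)
    (happ : ∀ (f : Lp ℂ 2 ν) (hf : W f ∈ H.domain),
      W.symm (H ⟨W f, hf⟩) =ᵐ[ν] fun x => (h x : ℂ) * f x) :
    IsSpectralMeasure H (mulPVM W hh) := by
  have hnn : ∀ f : Lp ℂ 2 ν, AEMeasurable (fun x => ‖f x‖₊ ^ 2) ν := fun f =>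
    ((Lp.stronglyMeasurable f).measurable.nnnorm.pow_const 2).aemeasurable
  refine ⟨fun ψ => ?_, fun ψ => ?_⟩
  · obtain ⟨f, rfl⟩ := W.surjective ψ
    have hm : AEStronglyMeasurable (fun x => (h x : ℂ) * f x) ν :=
      (Complex.measurable_ofReal.comp hh).aestronglyMeasurable.mul (Lp.aestronglyMeasurable f)
    rw [hdom, memLp_two_iff_integrable_sq_norm hm, vecMeasure_mulPVM,
      integrable_map_measure (by fun_prop) hh.aemeasurable, withDensity_enorm_sq,
      integrable_withDensity_iff_integrable_smul₀ (hnn f)]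
    refine integrable_congr (.of_forall fun x => ?_)
    simp [mul_pow, NNReal.smul_def, mul_comm]
  · obtain ⟨ψ, hψ⟩ := ψ
    obtain ⟨f, rfl⟩ := W.surjective ψ
    dsimp only
    rw [vecMeasure_mulPVM, integral_map hh.aemeasurable (by fun_prop), withDensity_enorm_sq,
      integral_withDensity_eq_integral_smul₀ (hnn f), ← W.symm.inner_map_map, W.symm_apply_apply,
      L2.inner_def, ← integral_complex_ofReal]
    refine integral_congr_ae ?_
    filter_upwards [happ f hψ] with x hx
    rw [hx, ← smul_eq_mul (h x : ℂ), inner_smul_right, inner_self_eq_norm_sq_to_K, mul_comm]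
    simp [NNReal.smul_def]

end MultiplicationPVM

/-! ### Existence of the spectral measure -/

section SpectralTheorem

variable {ℋ : Type*} [NormedAddCommGroup ℋ] [InnerProductSpace ℂ ℋ] [CompleteSpace ℋ]
  {H : ℋ →ₗ.[ℂ] ℋ}

/-- If the range of an isometry `J` is invariant under `R` and `R*`, with `R` injective, then
`R χ` lies in the range only if `χ` does. -/
theorem mem_range_of_apply_mem_range {X : Type*} [NormedAddCommGroup X] [InnerProductSpace ℂ X]
    [CompleteSpace X] (J : X →ₗᵢ[ℂ] ℋ) {R : ℋ →L[ℂ] ℋ} (hinj : ∀ χ, R χ = 0 → χ = 0)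
    (h1 : ∀ f, R (J f) ∈ Set.range J) (h2 : ∀ f, star R (J f) ∈ Set.range J) {χ : ℋ}
    (hχ : R χ ∈ Set.range J) : χ ∈ Set.range J := by
  set f := J.toContinuousLinearMap.adjoint χ with hf
  have hker : ∀ g, ⟪χ - J f, J g⟫_ℂ = 0 := by
    intro g
    rw [inner_sub_left, J.inner_map_map, hf, ContinuousLinearMap.adjoint_inner_left]
    simp
  -- `R*` preserves the range of `J`, so `R` preserves its orthogonal complement. But `R (χ - J f)`
  -- also lies in the range, hence is zero.
  have hR : ∀ g, ⟪R (χ - J f), J g⟫_ℂ = 0 := by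
    intro g
    obtain ⟨k, hk⟩ := h2 g
    rw [← ContinuousLinearMap.adjoint_inner_right, ← ContinuousLinearMap.star_eq_adjoint, ← hk]
    exact hker k
  obtain ⟨a, ha⟩ := hχ
  obtain ⟨b, hb⟩ := h1 f
  have hab : R (χ - J f) = J (a - b) := by rw [map_sub, map_sub, ha, hb]
  have h0 : R (χ - J f) = 0 := by
    have h3 := hR (a - b)
    rw [← hab] at h3
    exact inner_self_eq_zero.1 h3
  exact ⟨f, (sub_eq_zero.1 (hinj _ h0)).symm⟩

/-- The spectral theorem for a self-adjoint operator with a cyclic vector: a spectral measure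
exists. -/
theorem exists_isSpectralMeasure (hH : IsSelfAdjoint H) {φ : ℋ} (hφ : IsCyclicVector H φ) :
    ∃ E : PVM ℋ, IsSpectralMeasure H E := by
  obtain ⟨R, hR1, hR2, hR, hres⟩ := exists_normal_resolvent hH
  obtain ⟨ν, hν, J, hJφ, hJ⟩ := exists_isometry_of_isStarNormal hR φ
  have hinj : ∀ χ, R χ = 0 → χ = 0 := by
    intro χ h0
    obtain ⟨hd, h⟩ := hR1 χ
    have h1 : (⟨R χ, hd⟩ : H.domain) = 0 := Subtype.ext h0
    rw [h1, LinearPMap.map_zero, h0, smul_zero, add_zero] at h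
    exact h.symm
  set z : C(spectrum ℂ R, ℂ) := (ContinuousMap.id ℂ).restrict (spectrum ℂ R) with hz
  have hzx : ∀ x : spectrum ℂ R, z x = x := fun x => rfl
  have hcz : cfcHom hR z = R := cfcHom_id hR
  have hmem : ∀ g : C(spectrum ℂ R, ℂ), MemLp g ∞ ν := fun g =>
    memLp_top_of_bound g.continuous.aestronglyMeasurable ‖g‖ (.of_forall g.norm_coe_le_norm)
  have hRJ : ∀ f, R (J f) = J (mulOp z (hmem z) f) := by
    intro f
    have := hJ z (hmem z) f
    rwa [hcz] at this
  have hRsJ : ∀ f, star R (J f) = J (mulOp _ (hmem (star z)) f) := by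
    intro f
    have := hJ (star z) (hmem _) f
    rwa [map_star, hcz] at this
  have hsurj : Function.Surjective J := by
    obtain ⟨-, x, hx0, hx, hdense⟩ := hφ
    have hx' : ∀ n, (x n : ℋ) ∈ LinearMap.range J.toLinearMap := by
      intro n
      induction n with
      | zero => rw [hx0]; exact hJφ
      | succ n ih =>
        -- `R` sends this vector to `Hⁿφ`, which is in the range by induction.
        have h1 : H (x n) + Complex.I • (x n : ℋ) ∈ LinearMap.range J.toLinearMap :=
          mem_range_of_apply_mem_range J hinj (fun f => ⟨_, (hRJ f).symm⟩)
            (fun f => ⟨_, (hRsJ f).symm⟩) (by rw [hR2]; exact ih)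
        rw [hx n, ← add_sub_cancel_right (H (x n)) (Complex.I • (x n : ℋ))]
        exact Submodule.sub_mem _ h1 (Submodule.smul_mem _ _ ih)
    have hcl : IsClosed (Set.range J) := J.isometry.isClosedEmbedding.isClosed_range
    have hsub : (Submodule.span ℂ (Set.range fun n => (x n : ℋ)) : Set ℋ) ⊆ Set.range J := by
      have : Submodule.span ℂ (Set.range fun n => (x n : ℋ)) ≤ LinearMap.range J.toLinearMap :=
        Submodule.span_le.2 (by rintro _ ⟨n, rfl⟩; exact hx' n)
      exact this
    rw [← Set.range_eq_univ, ← Set.univ_subset_iff, ← hdense.closure_eq]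
    exact closure_minimal hsub hcl
  set W := LinearIsometryEquiv.ofSurjective J hsurj
  have hRW : ∀ f, R (W f) = W (mulOp z (hmem z) f) := hRJ
  -- Multiplication by `z` kills the indicator of `{0}`, so injectivity of `R` makes that set
  -- `ν`-null.
  have hne : ∀ᵐ x : spectrum ℂ R ∂ν, (x : ℂ) ≠ 0 := by
    have hm : MeasurableSet {x : spectrum ℂ R | (x : ℂ) = 0} :=
      (measurableSet_singleton (0 : ℂ)).preimage measurable_subtype_coe
    have h1 : mulOp z (hmem z) (indicatorConstLp 2 hm (measure_ne_top ν _) (1 : ℂ)) = 0 := by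
      rw [Lp.eq_zero_iff_ae_eq_zero]
      filter_upwards [coeFn_mulOp z (hmem z) (indicatorConstLp 2 hm (measure_ne_top ν _) (1 : ℂ)),
        indicatorConstLp_coeFn (μ := ν) (p := 2) (hs := hm) (hμs := measure_ne_top ν _)
          (c := (1 : ℂ))] with x h1 h2
      rw [h1, h2, hzx]
      by_cases h : x ∈ {x : spectrum ℂ R | (x : ℂ) = 0}
      · rw [show (x : ℂ) = 0 from h, zero_mul]
        rfl
      · rw [Set.indicator_of_notMem h, mul_zero]
        rfl
    have h2 := hinj (W (indicatorConstLp 2 hm (measure_ne_top ν _) (1 : ℂ)))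
      (by rw [hRW, h1, map_zero])
    rw [W.map_eq_zero_iff] at h2
    have h3 : ν {x : spectrum ℂ R | (x : ℂ) = 0} = 0 := by
      have h4 := norm_indicatorConstLp (μ := ν) (p := 2) (hs := hm)
        (hμs := measure_ne_top ν _) (c := (1 : ℂ)) (by simp) (by simp)
      rw [h2, norm_zero, norm_one, one_mul, eq_comm,
        Real.rpow_eq_zero measureReal_nonneg (by simp)] at h4
      exact (measureReal_eq_zero_iff).1 h4
    rw [ae_iff]
    simpa using h3
  have hspec : ∀ x : spectrum ℂ R,
      (starRingEnd ℂ) (x : ℂ) - x = 2 * Complex.I * ((starRingEnd ℂ) (x : ℂ) * x) := by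
    have : star z - z = (2 * Complex.I) • (star z * z) := by
      refine cfcHom_injective hR ?_
      rw [map_sub, map_smul, map_mul, map_star, hcz, hres]
    intro x
    exact congrArg (fun g : C(spectrum ℂ R, ℂ) => g x) this
  -- Heuristically `x = 1/(λ + i)`, so `λ = Re x⁻¹`; dividing `hspec` by `|x|²` gives `Im x⁻¹ = 1`,
  -- that is `x⁻¹ = h x + i`.
  let h : spectrum ℂ R → ℝ := fun x => ((x : ℂ)⁻¹).re
  have hh : Measurable h := Complex.measurable_re.comp (measurable_subtype_coe.inv)
  have hinv : ∀ x : spectrum ℂ R, (x : ℂ) ≠ 0 → (x : ℂ) * (h x + Complex.I) = 1 := by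
    intro x hx
    have hx' : (starRingEnd ℂ) (x : ℂ) ≠ 0 := (map_ne_zero _).2 hx
    have h1 : (x : ℂ)⁻¹ - (starRingEnd ℂ) (x : ℂ)⁻¹ = 2 * Complex.I := by
      rw [map_inv₀]
      field_simp
      linear_combination hspec x
    have h2 : (h x : ℂ) = ((x : ℂ)⁻¹ + (starRingEnd ℂ) (x : ℂ)⁻¹) / 2 :=
      Complex.re_eq_add_conj _
    have h3 : (h x : ℂ) + Complex.I = (x : ℂ)⁻¹ := by
      rw [h2]
      linear_combination (-1 / 2 : ℂ) * h1
    rw [h3, mul_inv_cancel₀ hx]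
  have happ : ∀ (f : Lp ℂ 2 ν) (hf : W f ∈ H.domain),
      W.symm (H ⟨W f, hf⟩) =ᵐ[ν] fun x => (h x : ℂ) * f x := by
    intro f hf
    set g := W.symm (H ⟨W f, hf⟩) with hg
    have h1 : H ⟨W f, hf⟩ = W g := by rw [hg, W.apply_symm_apply]
    have h2 := hR2 ⟨W f, hf⟩
    dsimp only at h2
    rw [h1, ← map_smul, ← map_add, hRW] at h2
    have h3 : mulOp z (hmem z) (g + Complex.I • f) = f := W.injective h2
    have h4 := coeFn_mulOp z (hmem z) (g + Complex.I • f)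
    rw [h3] at h4
    filter_upwards [h4, hne, Lp.coeFn_add g (Complex.I • f), Lp.coeFn_smul Complex.I f]
      with x h5 h6 h7 h8
    rw [h7, Pi.add_apply, h8, Pi.smul_apply, smul_eq_mul, hzx] at h5
    have h9 := hinv x h6
    linear_combination (-(h x : ℂ) - Complex.I) * h5 - (g x + Complex.I * f x) * h9
  refine ⟨mulPVM W hh, isSpectralMeasure_mulPVM W hh (fun f => ⟨fun hf => ?_, fun hf => ?_⟩) happ⟩
  · exact (memLp_congr_ae (happ f hf)).1 (Lp.memLp _)
  -- If `h f ∈ L²` then `f = z (h f + i f)`, so `W f` is in the range of `R`, which lies in the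
  -- domain of `H`.
  · have h1 : W f = R (W (hf.toLp _ + Complex.I • f)) := by
      rw [hRW]
      congr 1
      apply Lp.ext
      filter_upwards [coeFn_mulOp z (hmem z) (hf.toLp _ + Complex.I • f), hne, hf.coeFn_toLp,
        Lp.coeFn_add (hf.toLp _) (Complex.I • f), Lp.coeFn_smul Complex.I f] with x h5 h6 h7 h8 h9
      rw [h5, h8, Pi.add_apply, h7, h9, Pi.smul_apply, smul_eq_mul, hzx]
      linear_combination (-f x) * hinv x h6
    rw [h1]
    exact (hR1 _).1

end SpectralTheorem

/-! ### Transport of the time operator to `ℋ` -/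

section Transport

theorem isSymmetricOp_pullback {ℋ 𝒦 : Type*} [NormedAddCommGroup ℋ]
    [InnerProductSpace ℂ ℋ] [NormedAddCommGroup 𝒦] [InnerProductSpace ℂ 𝒦]
    (V : ℋ ≃ₗᵢ[ℂ] 𝒦) {S : 𝒦 →ₗ.[ℂ] 𝒦} (hS : IsSymmetricOp S) :
    IsSymmetricOp (pullback V S) := by
  refine ⟨hS.1.preimage V.toHomeomorph.isOpenMap, fun f g => ?_⟩
  have h := hS.2 ⟨V f, f.2⟩ ⟨V g, g.2⟩
  change ⟪V.symm (S ⟨V f, f.2⟩), (g : ℋ)⟫_ℂ = ⟪(f : ℋ), V.symm (S ⟨V g, g.2⟩)⟫_ℂ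
  rw [← V.inner_map_map, ← V.inner_map_map (f : ℋ), V.apply_symm_apply, V.apply_symm_apply]
  exact h

variable {ℋ : Type*} [NormedAddCommGroup ℋ] [InnerProductSpace ℂ ℋ] [CompleteSpace ℋ]
  {H : ℋ →ₗ.[ℂ] ℋ}

theorem IsRegularCyclic.isFisherDensity {φ : ℋ} {ρ : ℝ → ℝ} (h : IsRegularCyclic H φ ρ) :
    IsFisherDensity ρ where
  nonneg := h.nonneg
  differentiable := h.differentiable
  integrable := by
    refine ⟨h.differentiable.continuous.aestronglyMeasurable, ?_⟩
    have h1 := (spectralMeasure H).isFiniteMeasure_vecMeasure φ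
    change IsFiniteMeasure (specMeas H φ) at h1
    rw [h.density] at h1
    have h2 := h1.measure_univ_lt_top
    rw [withDensity_apply _ MeasurableSet.univ, Measure.restrict_univ] at h2
    rw [hasFiniteIntegral_iff_ofReal (.of_forall h.nonneg)]
    exact h2
  tendsto_atTop := h.tendsto_atTop
  tendsto_atBot := h.tendsto_atBot
  fisher := h.fisher

/-- In a spectral representation of `H`, the operator `e^{-itH}` is multiplication by `e^{-itx}`,
and the time operator of `L²(μ)` becomes a strong time operator of `H`. -/
theorem isStrongTimeOperator_pullback (hH : IsSelfAdjoint H) {ρ : ℝ → ℝ} (hρ : IsFisherDensity ρ)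
    (V : ℋ ≃ₗᵢ[ℂ] Lp ℂ 2 (densityMeasure ρ))
    (hV : Intertwines (spectralMeasure H) V.symm.toLinearIsometry) :
    IsStrongTimeOperator H (pullback V (timeOp (densityMeasure ρ) ρ)) := by
  have hm : ∀ t : ℝ, MemLp (fun x : ℝ => Complex.exp (-(Complex.I * t * x))) ∞
      (densityMeasure ρ) := fun t => by
    convert memLp_exp_I_mul (-t) using 3 with x
    push_cast
    ring
  refine ⟨hH, isSymmetricOp_pullback V hρ.isSymmetricOp_timeOp, fun t =>
    V.symm.toContinuousLinearEquiv.toContinuousLinearMap ∘L mulOp _ (hm t) ∘L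
      V.toContinuousLinearEquiv.toContinuousLinearMap, fun t ψ => ?_, fun t ψ => ?_⟩
  -- Both sides are `∫ e^{-itx} |Vψ|² dμ`, because `μ_ψ` has density `|Vψ|²` with respect to `μ`.
  · change ⟪ψ, V.symm (mulOp _ (hm t) (V ψ))⟫_ℂ = _
    rw [← V.inner_map_map, V.apply_symm_apply, inner_mulOp]
    have h1 := hV.integral_vecMeasure (V ψ) fun x : ℝ => Complex.exp (-(Complex.I * t * x))
    change ∫ x, _ ∂(spectralMeasure H).vecMeasure (V.symm (V ψ)) = _ at h1
    rw [V.symm_apply_apply] at h1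
    rw [specMeas, h1]
    refine integral_congr_ae (.of_forall fun x => ?_)
    dsimp only
    rw [inner_self_eq_norm_sq_to_K, Complex.real_smul, mul_comm]
    push_cast
    rfl
  · obtain ⟨h1, h2⟩ := hρ.timeOp_mulOp_exp t ⟨V ψ, ψ.2⟩ (hm t) fun _ => rfl
    have h3 : V (V.symm (mulOp _ (hm t) (V ψ))) ∈ (timeOp (densityMeasure ρ) ρ).domain := by
      rw [V.apply_symm_apply]
      exact h1
    refine ⟨h3, ?_⟩
    change V.symm (timeOp (densityMeasure ρ) ρ ⟨V (V.symm (mulOp _ (hm t) (V ψ))), h3⟩) =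
      V.symm (mulOp _ (hm t) (V (V.symm (timeOp (densityMeasure ρ) ρ ⟨V ψ, ψ.2⟩) +
        (t : ℂ) • (ψ : ℋ))))
    rw [map_add, map_smul, V.apply_symm_apply (timeOp (densityMeasure ρ) ρ ⟨V ψ, ψ.2⟩), ← h2]
    congr 2
    exact Subtype.ext (V.apply_symm_apply _)

/-- Existence of a spectral measure rules out the default branch of the definition. -/
theorem isSpectralMeasure_spectralMeasure (hH : IsSelfAdjoint H) {φ : ℋ}
    (hφ : IsCyclicVector H φ) : IsSpectralMeasure H (spectralMeasure H) := by
  have h := exists_isSpectralMeasure hH hφ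
  rw [spectralMeasure, dif_pos h]
  exact h.choose_spec

end Transport

end TimeOp

/-! ### The theorem -/

theorem theorem3 {ℋ : Type*} [NormedAddCommGroup ℋ] [InnerProductSpace ℂ ℋ] [CompleteSpace ℋ]
    [TopologicalSpace.SeparableSpace ℋ] (H : ℋ →ₗ.[ℂ] ℋ) (hH : TimeOp.InS0 H) :
    (∃ T : ℋ →ₗ.[ℂ] ℋ, TimeOp.IsStrongTimeOperator H T) ∧
    ∀ (φ : ℋ) (ρ : ℝ → ℝ), TimeOp.IsRegularCyclic H φ ρ →
      (∀ t : ℝ, ∃ f ∈ (TimeOp.timeOp (TimeOp.specMeas H φ) ρ).domain,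
        (f : ℝ → ℂ) =ᵐ[TimeOp.specMeas H φ] fun x => Complex.exp (Complex.I * t * x)) ∧
      (TimeOp.timeOp (TimeOp.specMeas H φ) ρ).graph =
        TimeOp.timeGraph (TimeOp.specMeas H φ) ρ ∧
      ∃ V : ℋ ≃ₗᵢ[ℂ] Lp ℂ 2 (TimeOp.specMeas H φ),
        ((V φ : ℝ → ℂ) =ᵐ[TimeOp.specMeas H φ] fun _ => 1) ∧
        TimeOp.pullback V (TimeOp.mulX (TimeOp.specMeas H φ)) = H ∧
        TimeOp.IsStrongTimeOperator H
          (TimeOp.pullback V (TimeOp.timeOp (TimeOp.specMeas H φ) ρ)) := by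
  have main : ∀ (φ : ℋ) (ρ : ℝ → ℝ), TimeOp.IsRegularCyclic H φ ρ →
      (∀ t : ℝ, ∃ f ∈ (TimeOp.timeOp (TimeOp.specMeas H φ) ρ).domain,
        (f : ℝ → ℂ) =ᵐ[TimeOp.specMeas H φ] fun x => Complex.exp (Complex.I * t * x)) ∧
      (TimeOp.timeOp (TimeOp.specMeas H φ) ρ).graph =
        TimeOp.timeGraph (TimeOp.specMeas H φ) ρ ∧
      ∃ V : ℋ ≃ₗᵢ[ℂ] Lp ℂ 2 (TimeOp.specMeas H φ),
        ((V φ : ℝ → ℂ) =ᵐ[TimeOp.specMeas H φ] fun _ => 1) ∧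
        TimeOp.pullback V (TimeOp.mulX (TimeOp.specMeas H φ)) = H ∧
        TimeOp.IsStrongTimeOperator H
          (TimeOp.pullback V (TimeOp.timeOp (TimeOp.specMeas H φ) ρ)) := by
    intro φ ρ h
    have hρ := h.isFisherDensity
    obtain ⟨V, hV1, hV2, hV3⟩ := TimeOp.exists_spectral_representation
      (TimeOp.isSpectralMeasure_spectralMeasure hH.selfAdjoint h.cyclic)
      hH.selfAdjoint.dense_domain h.cyclic
    have hμ : (TimeOp.spectralMeasure H).vecMeasure φ = TimeOp.densityMeasure ρ := h.density
    rw [TimeOp.specMeas]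
    -- The spaces `Lp ℂ 2 μ` depend on `μ`, so the equality `μ_φ = ρ dλ` is used by substitution for
    -- a variable measure.
    generalize (TimeOp.spectralMeasure H).vecMeasure φ = μ at *
    subst hμ
    exact ⟨hρ.exp_mem_timeOp_domain, hρ.timeOp_graph, V, hV1, hV2,
      TimeOp.isStrongTimeOperator_pullback hH.selfAdjoint hρ V hV3⟩
  obtain ⟨φ, ρ, h⟩ := hH.exists_cyclic
  obtain ⟨-, -, V, -, -, hT⟩ := main φ ρ h
  exact ⟨⟨_, hT⟩, main⟩
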